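/- Let $M$ be a II$_1$-factor with separable predual and trace $\tau$, acting in standard form on $L^2(M)=L^2(M,\tau)$, and write $\|x\|_2=\tau(x^*x)^{1/2}$. Let $N$ and $M_k$ ($k\in\mathbb N$) be von Neumann subalgebras of $M$ (with the same unit), and let $$\liminf_{k\to\infty}M_k=\{x\in B(L^2(M)) : \text{there are } x_k\in M_k \text{ with } x_k\to x \text{ in the strong-}* \text{ topology}\}.$$ Assume that there is a $*$-subalgebra $A\subset N$ which is dense in $N$ in the weak operator topology and satisfies $A\subset\liminf_{k\to\infty}M_k$. Then $$\Lambda(N)\le\liminf_{k\to\infty}\Lambda(M_k).$$ Moreover, if every $M_k$ is weakly exact, then so is $N$; and if every $M_k$ has the Haagerup approximation property, then so does $N$. Here, for a von Neumann algebra $P$ with predual $P_*$: (i) $\Lambda(P)\in[0,\infty]$ is the infimum of all $c\in[0,\infty)$ for which there is a sequence of normal finite rank maps $\Phi_j:P\to P$ with $\|\Phi_j\|_{cb}\le c$ for all $j$ and $\xi(\Phi_j(x)-x)\to0$ for all $x\in P$, $\xi\in P_*$ (and $\Lambda(P)=\infty$ if there is no such $c$). (ii) $P$ is weakly exact if for each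 finite dimensional operator system $X\subset P$ there are unital completely positive maps $\varphi_j:X\to M_{n(j)}(\mathbb C)$ and $\psi_j:\varphi_j(X)\to P$, $j\in\mathbb N$, such that $\xi(\psi_j\circ\varphi_j(x)-x)\to0$ for all $x\in X$, $\xi\in P_*$. (iii) A von Neumann subalgebra $P\subset M$ has the Haagerup approximation property if there is a sequence of unital completely positive maps $\varphi_j:P\to P$ with $\tau\circ\varphi_j=\tau|_P$ such that $\|\varphi_j(x)-x\|_2\to0$ for all $x\in P$ and each $\varphi_j$ induces a compact operator on $L^2(P,\tau|_P)$. -/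

import Mathlib

open Filter Topology
open scoped ENNReal NNReal

namespace VNLiminf

variable {H : Type*} [NormedAddCommGroup H] [InnerProductSpace ℂ H]
variable {K : Type*} [NormedAddCommGroup K] [InnerProductSpace ℂ K]

/-! ### Matrices of operators, complete positivity, completely bounded norm -/

/-- The operator on the Hilbert space `Hⁿ` given by an `n × n` matrix of operators on `H`;
this is the identification of `Mₙ(B(H))` with `B(Hⁿ)`. -/
noncomputable def matOp {n : ℕ} (a : Fin n → Fin n → (H →L[ℂ] H)) :
    PiLp 2 (fun _ : Fin n => H) →L[ℂ] PiLp 2 (fun _ : Fin n => H) :=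
  ((PiLp.continuousLinearEquiv 2 ℂ (fun _ : Fin n => H)).symm :
      (Fin n → H) →L[ℂ] PiLp 2 (fun _ : Fin n => H)) ∘L
    ContinuousLinearMap.pi (fun i => ∑ j, (a i j) ∘L PiLp.proj 2 (fun _ : Fin n => H) j)

theorem matOp_apply {n : ℕ} (a : Fin n → Fin n → (H →L[ℂ] H))
    (v : PiLp 2 (fun _ : Fin n => H)) (i : Fin n) :
    matOp a v i = ∑ j, a i j (v j) := by
  simp [matOp]

/-- A linear map `φ` from a subspace `X ⊆ B(H)` to `B(K)` is completely positive if for all `n`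
its entrywise application to matrices over `X` takes positive operators on `Hⁿ` to positive
operators on `Kⁿ`. -/
def IsCompletelyPositive {X : Submodule ℂ (H →L[ℂ] H)} (φ : X →ₗ[ℂ] (K →L[ℂ] K)) : Prop :=
  ∀ (n : ℕ) (a : Fin n → Fin n → X),
    (matOp (fun i j => (a i j : H →L[ℂ] H))).IsPositive →
      (matOp (fun i j => φ (a i j))).IsPositive

/-- Unital completely positive maps. -/
def IsUCP {X : Submodule ℂ (H →L[ℂ] H)} (φ : X →ₗ[ℂ] (K →L[ℂ] K)) : Prop :=
  IsCompletelyPositive φ ∧ ∀ x : X, (x : H →L[ℂ] H) = 1 → φ x = 1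

/-- The completely bounded norm `sup_n ‖id_{Mₙ} ⊗ φ‖`, with value `∞` if `φ` is not completely
bounded. -/
noncomputable def cbNorm {X : Submodule ℂ (H →L[ℂ] H)} (φ : X →ₗ[ℂ] (K →L[ℂ] K)) : ℝ≥0∞ :=
  ⨆ (n : ℕ) (a : Fin n → Fin n → X) (_ : ‖matOp (fun i j => (a i j : H →L[ℂ] H))‖ ≤ 1),
    ‖matOp (fun i j => φ (a i j))‖ₑ

variable [CompleteSpace H]

/-! ### Von Neumann algebras: underlying space, predual, normal maps -/

/-- The underlying linear subspace of `B(H)` of a von Neumann algebra on `H`. -/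
def space (M : VonNeumannAlgebra H) : Submodule ℂ (H →L[ℂ] H) :=
  Subalgebra.toSubmodule M.toStarSubalgebra.toSubalgebra

theorem mem_space {M : VonNeumannAlgebra H} {x : H →L[ℂ] H} : x ∈ space M ↔ x ∈ M := Iff.rfl

/-- The predual `M_*`: all `σ`-weakly continuous linear functionals on `M ⊆ B(H)`, that is, those
of the form `x ↦ ∑ᵢ ⟨ζᵢ, x ηᵢ⟩` with `∑ᵢ ‖ζᵢ‖² < ∞` and `∑ᵢ ‖ηᵢ‖² < ∞`. -/
def predual (M : VonNeumannAlgebra H) : Set (space M →ₗ[ℂ] ℂ) :=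
  {ξ | ∃ ζ η : ℕ → H, Summable (fun i => ‖ζ i‖ ^ 2) ∧ Summable (fun i => ‖η i‖ ^ 2) ∧
    ∀ x : space M, HasSum (fun i => inner ℂ (ζ i) ((x : H →L[ℂ] H) (η i))) (ξ x)}

/-- A map of a von Neumann algebra to itself is normal if it is `σ`-weakly continuous, that is,
if the composition with it maps the predual to itself. -/
def IsNormalMap {M : VonNeumannAlgebra H} (Φ : space M →ₗ[ℂ] space M) : Prop :=
  ∀ ξ ∈ predual M, ξ ∘ₗ Φ ∈ predual M

/-- A `II₁`-factor: a von Neumann algebra with trivial centre, infinite dimensional, with a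
faithful normal tracial state. -/
def IsIIOneFactor (M : VonNeumannAlgebra H) : Prop :=
  (∀ x ∈ M, x ∈ M.commutant → ∃ c : ℂ, x = c • (1 : H →L[ℂ] H)) ∧
  ¬ FiniteDimensional ℂ (space M) ∧
  ∃ τ ∈ predual M,
    (∀ x : space M, (x : H →L[ℂ] H) = 1 → τ x = 1) ∧
    (∀ x y : space M, (y : H →L[ℂ] H) = star (x : H →L[ℂ] H) * x →
      0 ≤ (τ y).re ∧ (τ y).im = 0 ∧ (τ y = 0 → x = 0)) ∧
    (∀ x y z w : space M, (z : H →L[ℂ] H) = (x : H →L[ℂ] H) * y →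
      (w : H →L[ℂ] H) = (y : H →L[ℂ] H) * x → τ z = τ w)

/-- `M ⊆ B(H)` is in standard form `H = L²(M)`, `ω` being the vector `1̂`: the unit vector `ω`
is cyclic for `M` and the vector state `x ↦ ⟨ω, x ω⟩` is a trace on `M`. These data are, up to a
unitary which is unique, the GNS representation of `M` with respect to that trace. -/
def IsStandardForm (M : VonNeumannAlgebra H) (ω : H) : Prop :=
  ‖ω‖ = 1 ∧
  Dense {v : H | ∃ x ∈ M, v = x ω} ∧
  ∀ x ∈ M, ∀ y ∈ M, inner ℂ ω ((x * y) ω) = inner ℂ ω ((y * x) ω)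

/-! ### Limes inferior and weak density -/

/-- The limes inferior of a sequence of von Neumann algebras on `H`: all limits in the
strong-`*` topology of sequences `xₖ ∈ Mₖ`. -/
def liminfVN (M : ℕ → VonNeumannAlgebra H) : Set (H →L[ℂ] H) :=
  {x | ∃ y : ℕ → (H →L[ℂ] H), (∀ k, y k ∈ M k) ∧
    ∀ v : H, Tendsto (fun k => y k v) atTop (𝓝 (x v)) ∧
      Tendsto (fun k => star (y k) v) atTop (𝓝 (star x v))}

/-- Every element of `N` is in the closure of `A` in the weak operator topology. -/
def IsWeaklyDenseIn (A : NonUnitalStarSubalgebra ℂ (H →L[ℂ] H)) (N : VonNeumannAlgebra H) :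
    Prop :=
  ∀ x ∈ N, (ContinuousLinearMapWOT.ofCLM x : H →WOT[ℂ] H) ∈
    closure ((ContinuousLinearMapWOT.ofCLM : (H →L[ℂ] H) → (H →WOT[ℂ] H)) ''
      (A : Set (H →L[ℂ] H)))

/-! ### Approximation properties -/

/-- The relation `Λ(M) ≤ c` of the definition of the Haagerup invariant: there are normal finite
rank maps `Φₖ : M → M` of completely bounded norm at most `c` that converge to the identity in
the point-`σ`-weak topology. -/
def HasCBApprox (M : VonNeumannAlgebra H) (c : ℝ≥0) : Prop :=
  ∃ Φ : ℕ → (space M →ₗ[ℂ] space M),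
    (∀ k, IsNormalMap (Φ k)) ∧
    (∀ k, FiniteDimensional ℂ (LinearMap.range (Φ k))) ∧
    (∀ k, cbNorm ((space M).subtype ∘ₗ Φ k) ≤ c) ∧
    ∀ x : space M, ∀ ξ ∈ predual M, Tendsto (fun k => ξ (Φ k x - x)) atTop (𝓝 0)

/-- The Haagerup invariant `Λ(M) ∈ [0, ∞]`, the infimum of all such `c`; it is `∞` if there is
none. -/
noncomputable def haagerupInvariant (M : VonNeumannAlgebra H) : ℝ≥0∞ :=
  ⨅ (c : ℝ≥0) (_ : HasCBApprox M c), (c : ℝ≥0∞)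

/-- Weak exactness: on every finite dimensional operator system `X ⊆ M` the identity is a
point-`σ`-weak limit of maps `ψₖ ∘ φₖ` with `φₖ : X → M_{n(k)}(ℂ)` and `ψₖ : φₖ(X) → M` unital
completely positive. The matrix algebra `Mₙ(ℂ)` is `B(ℂⁿ)`. -/
def IsWeaklyExact (M : VonNeumannAlgebra H) : Prop :=
  ∀ X : Submodule ℂ (H →L[ℂ] H), FiniteDimensional ℂ X → 1 ∈ X → (∀ x ∈ X, star x ∈ X) →
    ∀ hX : X ≤ space M,
    ∃ (n : ℕ → ℕ)
      (φ : ∀ k, X →ₗ[ℂ] (EuclideanSpace ℂ (Fin (n k)) →L[ℂ] EuclideanSpace ℂ (Fin (n k))))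
      (ψ : ∀ k, LinearMap.range (φ k) →ₗ[ℂ] space M),
      (∀ k, IsUCP (φ k)) ∧ (∀ k, IsUCP ((space M).subtype ∘ₗ ψ k)) ∧
      ∀ x : X, ∀ ξ ∈ predual M,
        Tendsto (fun k => ξ (ψ k ((φ k).rangeRestrict x) - Submodule.inclusion hX x))
          atTop (𝓝 0)

/-- For a von Neumann algebra `N` on `H` and a unit vector `ω` whose vector state `τ` is a
faithful trace on `N`: the GNS space `L²(N, τ)`, realized as the closure of `N ω`
(where `x̂` is `x ω`, so that `‖x‖₂ = ‖x ω‖`). -/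
noncomputable def L2 (N : VonNeumannAlgebra H) (ω : H) : Submodule ℂ H :=
  ((space N).map (ContinuousLinearMap.apply ℂ H ω).toLinearMap).topologicalClosure

theorem apply_mem_L2 (N : VonNeumannAlgebra H) (ω : H) (x : space N) :
    (x : H →L[ℂ] H) ω ∈ L2 N ω :=
  Submodule.le_topologicalClosure _ ⟨x, x.2, rfl⟩

/-- The Haagerup approximation property of `(N, τ)`, where `τ` is the trace `x ↦ ⟨ω, x ω⟩`:
there are unital completely positive `τ`-preserving maps `φₙ : N → N` with `‖φₙ(x) - x‖₂ → 0`
for all `x` that induce compact operators on `L²(N, τ)`. -/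
def HasHaagerupAP (N : VonNeumannAlgebra H) (ω : H) : Prop :=
  ∃ φ : ℕ → (space N →ₗ[ℂ] space N),
    (∀ n, IsUCP ((space N).subtype ∘ₗ φ n)) ∧
    (∀ n, ∀ x : space N,
      inner ℂ ω ((φ n x : H →L[ℂ] H) ω) = inner ℂ ω ((x : H →L[ℂ] H) ω)) ∧
    (∀ x : space N,
      Tendsto (fun n => ‖((φ n x - x : space N) : H →L[ℂ] H) ω‖) atTop (𝓝 0)) ∧
    ∀ n, ∃ T : L2 N ω →L[ℂ] L2 N ω, IsCompactOperator T ∧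
      ∀ x : space N, T ⟨(x : H →L[ℂ] H) ω, apply_mem_L2 N ω x⟩ =
        ⟨(φ n x : H →L[ℂ] H) ω, apply_mem_L2 N ω (φ n x)⟩

end VNLiminf

namespace VNLiminf

/-! ### Functional calculus, the predual and its bidual description -/

section Basics

variable {H : Type*} [NormedAddCommGroup H] [InnerProductSpace ℂ H] [CompleteSpace H]

/-! Let `E` and `E_k` be the trace-preserving conditional expectations of `M` onto `N` and `M_k`. On
the trace vector they act as the orthogonal projections onto `L2 N ω` and `L2 (Mk k) ω`. Each `a ∈
A` is a strong limit of elements of the `M_k`, so the projections onto `L2 (Mk k) ω` converge to the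
identity on `Aω`, hence on the closure of `Aω`, which contains `Nω`. Thus `‖E_k x - x‖₂ → 0` for `x
∈ N`, and boundedness together with normality of `E` gives `E (E_k x) → x` σ-weakly
(`IsInLiminf.tendsto_condExp`).

An approximating map `Φ` of `M_k` therefore yields the approximating map `E ∘ Φ ∘ E_k` of `N`. The
expectations are unital completely positive, completely contractive, normal and trace-preserving, so
bounds on the completely bounded norm, finite rank, factorizations through matrices and compactness
on `L²` all survive.

What remains is to turn approximation at finitely many points into a sequence. For the Haagerup
property, `L²` is separable and the maps are `‖·‖₂`-contractive; for weak exactness, a basis of `X`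
suffices. For `Λ`, the points of `N` need not be norm separable, so a Hahn-Banach argument in a
finite power of the dual (`exists_uniform_of_pointwise`) first upgrades pointwise estimates to
estimates uniform on the unit ball; then countably many vector functionals are enough.

The expectation itself comes from `exists_condExp`: an approximate polar decomposition bounds `y ↦
τ(xy)` by the norm of the functional `τ(· y)` on `N`, and Hahn-Banach with the bicommutant theorem
produces `E x`. Its complete positivity and contractivity follow from `isPositive_of_L2`, since on
`L2 N ω` it is the compression of `x`. -/

theorem mem_of_commute_commutant {N : VonNeumannAlgebra H} {x : H →L[ℂ] H}
    (h : ∀ y ∈ N.commutant, y * x = x * y) : x ∈ N := by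
  rw [← N.commutant_commutant]
  exact VonNeumannAlgebra.mem_commutant_iff.2 h

theorem commute_of_mem_commutant {N : VonNeumannAlgebra H} {x y : H →L[ℂ] H}
    (hx : x ∈ N) (hy : y ∈ N.commutant) : Commute x y :=
  VonNeumannAlgebra.mem_commutant_iff.1 hy x hx

theorem cfc_mem_of_mem {N : VonNeumannAlgebra H} {x : H →L[ℂ] H} (hx : x ∈ N) (f : ℝ → ℝ) :
    cfc f x ∈ N :=
  mem_of_commute_commutant fun _ hy =>
    ((commute_of_mem_commutant hx hy).cfc_real f).symm.eq

/-- Approximate polar decomposition `y = u |y|` inside a von Neumann algebra, with `k` in the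
role of `|y|^{1/2}`. -/
theorem exists_approx_polar {N : VonNeumannAlgebra H} {y : H →L[ℂ] H} (hy : y ∈ N) {ε : ℝ}
    (hε : 0 < ε) :
    ∃ u ∈ N, ∃ k ∈ N, star k = k ∧ ‖u‖ ≤ 1 ∧ y = u * (k * k) ∧
      ‖star u * y - k * k‖ ≤ ε := by
  set a : H →L[ℂ] H := star y * y with ha
  have haN : a ∈ N := mul_mem (star_mem hy) hy
  have hsa : IsSelfAdjoint a := .star_mul_self y
  have hpos : ∀ t ∈ spectrum ℝ a, 0 ≤ t := fun t ht =>
    spectrum_nonneg_of_nonneg (star_mul_self_nonneg y) ht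
  -- A regularized square root: `g a` replaces `|y|` but is bounded below by `ε`, so it is
  -- invertible and `u = y (g a)⁻¹` lies in `N`, with `y = u g(a)` exactly. The price is the error
  -- `ε² / g ≤ ε` in `star u * y - g a`.
  let g : ℝ → ℝ := fun t => √(|t| + ε ^ 2)
  have hg : ∀ t, 0 < g t := fun t => Real.sqrt_pos.2 (by positivity)
  have hgc : Continuous g := by fun_prop
  have hgi : Continuous fun t => (g t)⁻¹ := hgc.inv₀ fun t => (hg t).ne'
  have hmi : Continuous fun t => t * (g t)⁻¹ := continuous_id.mul hgi
  have him : Continuous fun t => (g t)⁻¹ * t := hgi.mul continuous_id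
  have hgs : Continuous fun t => √(g t) := by fun_prop
  have hgε : ∀ t, ε ≤ g t := fun t => Real.le_sqrt_of_sq_le (by linarith [abs_nonneg t])
  have hg2 : ∀ t ∈ spectrum ℝ a, g t * g t = t + ε ^ 2 := fun t ht => by
    simp only [g]
    rw [Real.mul_self_sqrt (by positivity), abs_of_nonneg (hpos t ht)]
  set k := cfc (fun t => √(g t)) a with hk
  set r := cfc (fun t => (g t)⁻¹) a with hr
  have hrs : star r = r := (cfc_predicate (fun t => (g t)⁻¹) a : IsSelfAdjoint _)
  have hkk : k * k = cfc g a := by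
    rw [hk, ← cfc_mul _ _ a hgs.continuousOn hgs.continuousOn]
    exact cfc_congr fun t _ => Real.mul_self_sqrt (hg t).le
  have hid : cfc (fun t : ℝ => t) a = a := cfc_id ℝ a
  refine ⟨y * r, mul_mem hy (cfc_mem_of_mem haN _), k, cfc_mem_of_mem haN _,
    (cfc_predicate (fun t => √(g t)) a : IsSelfAdjoint _), ?_, ?_, ?_⟩
  · have h1 : star (y * r) * (y * r) = cfc (fun t => (g t)⁻¹ * (t * (g t)⁻¹)) a := by
      rw [cfc_mul _ _ a hgi.continuousOn hmi.continuousOn,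
        cfc_mul _ _ a (continuous_id' (X := ℝ)).continuousOn hgi.continuousOn, hid, star_mul, hrs, ← hr, ha]
      simp only [mul_assoc]
    have h2 : ‖star (y * r) * (y * r)‖ ≤ 1 := by
      rw [h1]
      refine norm_cfc_le zero_le_one fun t ht => ?_
      have h3 := hpos t ht
      have h4 := hg t
      rw [Real.norm_of_nonneg (by positivity)]
      have : (g t)⁻¹ * (t * (g t)⁻¹) = t / (g t * g t) := by field_simp
      rw [this, hg2 t ht]
      exact div_le_one_of_le₀ (by nlinarith) (by positivity)
    rw [CStarRing.norm_star_mul_self] at h2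
    nlinarith [norm_nonneg (y * r)]
  · have h1 : r * (k * k) = 1 := by
      rw [hkk, hr, ← cfc_mul _ _ a hgi.continuousOn hgc.continuousOn,
        ← cfc_one ℝ a hsa]
      exact cfc_congr fun t _ => inv_mul_cancel₀ (hg t).ne'
    rw [mul_assoc, h1, mul_one]
  · have h1 : star (y * r) * y - k * k = cfc (fun t => (g t)⁻¹ * t - g t) a := by
      rw [cfc_sub _ _ a him.continuousOn hgc.continuousOn,
        cfc_mul _ _ a hgi.continuousOn (continuous_id' (X := ℝ)).continuousOn, hid, star_mul, hrs, hkk, mul_assoc]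
    rw [h1]
    refine norm_cfc_le hε.le fun t ht => ?_
    have h4 := hg t
    have : (g t)⁻¹ * t - g t = -(ε ^ 2 / g t) := by
      field_simp
      nlinarith [hg2 t ht]
    rw [this, norm_neg, Real.norm_of_nonneg (by positivity), div_le_iff₀ h4]
    nlinarith [hgε t]

/-- The Banach space dual of a von Neumann algebra. -/
def BoundedDual (N : VonNeumannAlgebra H) : Type _ := StrongDual ℂ (space N)

namespace BoundedDual

variable {N : VonNeumannAlgebra H}

noncomputable instance : NormedAddCommGroup (BoundedDual N) :=
  inferInstanceAs (NormedAddCommGroup (StrongDual ℂ (space N)))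

noncomputable instance : NormedSpace ℂ (BoundedDual N) :=
  inferInstanceAs (NormedSpace ℂ (StrongDual ℂ (space N)))

instance : CompleteSpace (BoundedDual N) :=
  inferInstanceAs (CompleteSpace (StrongDual ℂ (space N)))

/-- The underlying linear functional. -/
noncomputable def toLin : BoundedDual N →ₗ[ℂ] (space N →ₗ[ℂ] ℂ) where
  toFun ξ := (show StrongDual ℂ (space N) from ξ : space N →ₗ[ℂ] ℂ)
  map_add' _ _ := rfl
  map_smul' _ _ := rfl

theorem toLin_injective : Function.Injective (toLin (N := N)) := fun _ _ h =>
  ContinuousLinearMap.coe_injective h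

theorem norm_toLin_apply_le (ξ : BoundedDual N) (x : space N) :
    ‖ξ.toLin x‖ ≤ ‖ξ‖ * ‖(x : H →L[ℂ] H)‖ :=
  ContinuousLinearMap.le_opNorm (show StrongDual ℂ (space N) from ξ) x

/-- The evaluation at an element of `N`. -/
noncomputable def eval (x : space N) : BoundedDual N →L[ℂ] ℂ :=
  ContinuousLinearMap.apply ℂ ℂ x

theorem norm_le (ξ : BoundedDual N) {C : ℝ} (hC : 0 ≤ C)
    (h : ∀ x : space N, ‖ξ.toLin x‖ ≤ C * ‖(x : H →L[ℂ] H)‖) : ‖ξ‖ ≤ C :=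
  ContinuousLinearMap.opNorm_le_bound (show StrongDual ℂ (space N) from ξ) hC h

end BoundedDual

/-- The vector functional `x ↦ ⟨ζ, x η⟩` on a von Neumann algebra. -/
noncomputable def vecFunctional (N : VonNeumannAlgebra H) (ζ η : H) : BoundedDual N :=
  (innerSL ℂ ζ) ∘L (ContinuousLinearMap.apply ℂ H η) ∘L (space N).subtypeL

theorem vecFunctional_apply (N : VonNeumannAlgebra H) (ζ η : H) (x : space N) :
    (vecFunctional N ζ η).toLin x = inner ℂ ζ ((x : H →L[ℂ] H) η) := rfl

theorem norm_inner_apply_le {E : Type*} [NormedAddCommGroup E] [InnerProductSpace ℂ E]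
    (x : E →L[ℂ] E) (ζ η : E) :
    ‖inner ℂ ζ (x η)‖ ≤ ‖x‖ * ‖ζ‖ * ‖η‖ :=
  calc _ ≤ ‖ζ‖ * ‖x η‖ := norm_inner_le_norm _ _
    _ ≤ ‖ζ‖ * (‖x‖ * ‖η‖) := by gcongr; exact ContinuousLinearMap.le_opNorm _ _
    _ = _ := by ring

theorem norm_vecFunctional_le (N : VonNeumannAlgebra H) (ζ η : H) :
    ‖vecFunctional N ζ η‖ ≤ ‖ζ‖ * ‖η‖ :=
  (vecFunctional N ζ η).norm_le (by positivity) fun x =>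
    (norm_inner_apply_le (x : H →L[ℂ] H) ζ η).trans (by linarith)

theorem summable_mul_of_summable_sq {f g : ℕ → ℝ} (hf : Summable fun i => f i ^ 2)
    (hg : Summable fun i => g i ^ 2) (hf0 : ∀ i, 0 ≤ f i) (hg0 : ∀ i, 0 ≤ g i) :
    Summable fun i => f i * g i :=
  Summable.of_nonneg_of_le (fun i => mul_nonneg (hf0 i) (hg0 i))
    (fun i => by nlinarith [sq_nonneg (f i - g i), sq_nonneg (f i), sq_nonneg (g i)]) (hf.add hg)

/-- Elements of the predual are norm convergent sums of vector functionals. -/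
theorem exists_hasSum_vecFunctional {N : VonNeumannAlgebra H} {ξ : space N →ₗ[ℂ] ℂ}
    (hξ : ξ ∈ predual N) :
    ∃ ξ' : BoundedDual N, ξ'.toLin = ξ ∧
      ∃ ζ η : ℕ → H, HasSum (fun i => vecFunctional N (ζ i) (η i)) ξ' := by
  obtain ⟨ζ, η, hζ, hη, h⟩ := hξ
  have hs : Summable fun i => vecFunctional N (ζ i) (η i) :=
    Summable.of_norm_bounded
      (summable_mul_of_summable_sq hζ hη (fun _ => norm_nonneg _) fun _ => norm_nonneg _)
      fun i => norm_vecFunctional_le N _ _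
  refine ⟨_, LinearMap.ext fun x => ?_, ζ, η, hs.hasSum⟩
  exact ((hs.hasSum.mapL (BoundedDual.eval x)).unique (h x))

/-- Every bounded functional on the dual of a von Neumann algebra `N` acts on the predual of `N`
as the evaluation at an element of `N`. -/
theorem exists_eval_of_dual (N : VonNeumannAlgebra H) (F : BoundedDual N →L[ℂ] ℂ) :
    ∃ z : space N, (∀ ζ η, F (vecFunctional N ζ η) = inner ℂ ζ ((z : H →L[ℂ] H) η)) ∧
      ∀ ξ : BoundedDual N, ξ.toLin ∈ predual N → F ξ = ξ.toLin z := by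
  let B : H →L⋆[ℂ] H →L[ℂ] ℂ := LinearMap.mkContinuous₂
    (LinearMap.mk₂'ₛₗ (starRingEnd ℂ) (RingHom.id ℂ) (fun ζ η => F (vecFunctional N ζ η))
      (fun a b c => by
        rw [← map_add]; congr 1
        refine BoundedDual.toLin_injective (LinearMap.ext fun x => ?_)
        simp [vecFunctional_apply])
      (fun c a b => by
        rw [← map_smul]; congr 1
        refine BoundedDual.toLin_injective (LinearMap.ext fun x => ?_)
        simp [vecFunctional_apply, mul_comm])
      (fun a b c => by
        rw [← map_add]; congr 1
        refine BoundedDual.toLin_injective (LinearMap.ext fun x => ?_)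
        simp [vecFunctional_apply])
      (fun c a b => by
        rw [← map_smul]; congr 1
        refine BoundedDual.toLin_injective (LinearMap.ext fun x => ?_)
        simp [vecFunctional_apply]))
    ‖F‖ (fun ζ η => by
      calc _ ≤ ‖F‖ * ‖vecFunctional N ζ η‖ := F.le_opNorm _
        _ ≤ ‖F‖ * (‖ζ‖ * ‖η‖) := by gcongr; exact norm_vecFunctional_le N ζ η
        _ = _ := by ring)
  -- `F` on vector functionals is a bounded sesquilinear form, hence given by an operator.
  let z : H →L[ℂ] H := star (InnerProductSpace.continuousLinearMapOfBilin B)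
  have hz : ∀ ζ η, F (vecFunctional N ζ η) = inner ℂ ζ (z η) := fun ζ η => by
    rw [show z = ContinuousLinearMap.adjoint _ from rfl, ContinuousLinearMap.adjoint_inner_right,
      InnerProductSpace.continuousLinearMapOfBilin_apply]
    rfl
  have hzN : z ∈ N := by
    refine mem_of_commute_commutant fun y hy => ?_
    ext η
    refine ext_inner_left ℂ fun ζ => ?_
    -- On `N` an operator of the commutant can be moved across the inner product, so `z` commutes
    -- with it; the bicommutant theorem puts `z` in `N`.
    have h1 : vecFunctional N (star y ζ) η = vecFunctional N ζ (y η) := by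
      refine BoundedDual.toLin_injective (LinearMap.ext fun x => ?_)
      have h2 := commute_of_mem_commutant (show (x : H →L[ℂ] H) ∈ N from x.2) hy
      rw [vecFunctional_apply, vecFunctional_apply, ContinuousLinearMap.star_eq_adjoint,
        ContinuousLinearMap.adjoint_inner_left]
      exact congrArg (inner ℂ ζ) (DFunLike.congr_fun h2.symm.eq η)
    rw [mul_apply_eq_comp, mul_apply_eq_comp, ← hz, ← h1, hz,
      ContinuousLinearMap.star_eq_adjoint, ContinuousLinearMap.adjoint_inner_left]
  refine ⟨⟨z, hzN⟩, hz, fun ξ hξ => ?_⟩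
  obtain ⟨ξ', h1, ζ, η, h2⟩ := exists_hasSum_vecFunctional hξ
  obtain rfl : ξ = ξ' := BoundedDual.toLin_injective h1.symm
  have h3 := h2.mapL F
  have h4 := h2.mapL (BoundedDual.eval ⟨z, hzN⟩)
  simp only [hz] at h3
  exact h3.unique h4

/-- Restriction of normal functionals to a von Neumann subalgebra. -/
theorem comp_inclusion_mem_predual {P N : VonNeumannAlgebra H} (h : space P ≤ space N)
    {ξ : space N →ₗ[ℂ] ℂ} (hξ : ξ ∈ predual N) :
    ξ ∘ₗ Submodule.inclusion h ∈ predual P := by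
  obtain ⟨ζ, η, hζ, hη, hs⟩ := hξ
  exact ⟨ζ, η, hζ, hη, fun x => hs (Submodule.inclusion h x)⟩

theorem vecFunctional_mem_predual (N : VonNeumannAlgebra H) (ζ η : H) :
    (vecFunctional N ζ η).toLin ∈ predual N := by
  refine ⟨Pi.single 0 ζ, Pi.single 0 η, ?_, ?_, fun x => ?_⟩
  · exact summable_of_ne_finset_zero (s := {0}) fun i hi => by simp_all
  · exact summable_of_ne_finset_zero (s := {0}) fun i hi => by simp_all
  · have := hasSum_single (f := fun i => inner ℂ ((Pi.single 0 ζ : ℕ → H) i)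
      ((x : H →L[ℂ] H) ((Pi.single 0 η : ℕ → H) i))) 0 (fun i hi => by simp [hi])
    rw [vecFunctional_apply]
    simpa using this

/-- Bounded sequences of operators that converge weakly on a dense set of vectors converge
`σ`-weakly. -/
theorem tendsto_predual_of_dense {N : VonNeumannAlgebra H} {T : ℕ → space N} {C : ℝ}
    (hT : ∀ j, ‖(T j : H →L[ℂ] H)‖ ≤ C) {D : Set H} (hD : Dense D)
    (h : ∀ v ∈ D, ∀ w ∈ D, Tendsto (fun j => inner ℂ v ((T j : H →L[ℂ] H) w)) atTop (𝓝 0))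
    {ξ : space N →ₗ[ℂ] ℂ} (hξ : ξ ∈ predual N) : Tendsto (fun j => ξ (T j)) atTop (𝓝 0) := by
  have hC : 0 ≤ C := (norm_nonneg _).trans (hT 0)
  have hb : ∀ j (v w : H), ‖inner ℂ v ((T j : H →L[ℂ] H) w)‖ ≤ C * ‖v‖ * ‖w‖ := fun j v w =>
    (norm_inner_apply_le _ v w).trans (by gcongr; exact hT j)
  have h1 : ∀ v ∈ D, ∀ w, Tendsto (fun j => inner ℂ v ((T j : H →L[ℂ] H) w)) atTop (𝓝 0) := by
    intro v hv w
    rw [Metric.tendsto_atTop]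
    intro ε hε
    obtain ⟨w', hw', hww⟩ := Metric.dense_iff.1 hD w (ε / 2 / (C * ‖v‖ + 1)) (by positivity)
    rw [Metric.mem_ball, dist_comm, dist_eq_norm] at hw'
    obtain ⟨n, hn⟩ := Metric.tendsto_atTop.1 (h v hv w' hww) (ε / 2) (by positivity)
    refine ⟨n, fun j hj => ?_⟩
    have h2 := hn j hj
    rw [dist_zero_right] at h2 ⊢
    have h3 := hb j v (w - w')
    have h4 : C * ‖v‖ * ‖w - w'‖ ≤ ε / 2 := by
      rw [lt_div_iff₀ (by positivity)] at hw'
      nlinarith [norm_nonneg (w - w')]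
    have h5 : inner ℂ v ((T j : H →L[ℂ] H) w) =
        inner ℂ v ((T j : H →L[ℂ] H) (w - w')) + inner ℂ v ((T j : H →L[ℂ] H) w') := by
      rw [map_sub, inner_sub_right, sub_add_cancel]
    rw [h5]
    exact (norm_add_le _ _).trans_lt (by linarith)
  have h2 : ∀ v w, Tendsto (fun j => inner ℂ v ((T j : H →L[ℂ] H) w)) atTop (𝓝 0) := by
    intro v w
    rw [Metric.tendsto_atTop]
    intro ε hε
    obtain ⟨v', hv', hvv⟩ := Metric.dense_iff.1 hD v (ε / 2 / (C * ‖w‖ + 1)) (by positivity)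
    rw [Metric.mem_ball, dist_comm, dist_eq_norm] at hv'
    obtain ⟨n, hn⟩ := Metric.tendsto_atTop.1 (h1 v' hvv w) (ε / 2) (by positivity)
    refine ⟨n, fun j hj => ?_⟩
    have h2 := hn j hj
    rw [dist_zero_right] at h2 ⊢
    have h3 := hb j (v - v') w
    have h4 : C * ‖v - v'‖ * ‖w‖ ≤ ε / 2 := by
      rw [lt_div_iff₀ (by positivity)] at hv'
      nlinarith [norm_nonneg (v - v')]
    have h5 : inner ℂ v ((T j : H →L[ℂ] H) w) =
        inner ℂ (v - v') ((T j : H →L[ℂ] H) w) + inner ℂ v' ((T j : H →L[ℂ] H) w) := by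
      rw [inner_sub_left, sub_add_cancel]
    rw [h5]
    exact (norm_add_le _ _).trans_lt (by linarith)
  obtain ⟨ζ, η, hζ, hη, hs⟩ := hξ
  have h3 := tendsto_tsum_of_dominated_convergence
    (f := fun j i => inner ℂ (ζ i) ((T j : H →L[ℂ] H) (η i))) (𝓕 := atTop) (g := fun _ => 0)
    ((summable_mul_of_summable_sq hζ hη (fun _ => norm_nonneg _)
      fun _ => norm_nonneg _).mul_left C) (fun i => h2 _ _)
    (Eventually.of_forall fun j i => by simpa only [mul_assoc] using hb j (ζ i) (η i))
  simp only [tsum_zero] at h3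
  exact h3.congr fun j => (hs (T j)).tsum_eq

/-- Hahn-Banach: a linear map `g` dominated by the norm of a linear map `L` factors through `L`
up to a bounded functional. -/
theorem exists_dual_comp_eq {V E : Type*} [AddCommGroup V] [Module ℂ V] [NormedAddCommGroup E]
    [NormedSpace ℂ E] (L : V →ₗ[ℂ] E) (g : V →ₗ[ℂ] ℂ) (C : ℝ) (h : ∀ v, ‖g v‖ ≤ C * ‖L v‖) :
    ∃ F : StrongDual ℂ E, ∀ v, F (L v) = g v := by
  obtain ⟨s, hs⟩ := LinearMap.exists_rightInverse_of_surjective L.rangeRestrict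
    (LinearMap.range_rangeRestrict L)
  have hs' : ∀ p : LinearMap.range L, L (s p) = p := fun p =>
    congrArg Subtype.val (DFunLike.congr_fun hs p)
  let F₀ : StrongDual ℂ (LinearMap.range L) := (g ∘ₗ s).mkContinuous C fun p => by
    have := h (s p)
    rwa [hs'] at this
  obtain ⟨F, hF, -⟩ := exists_extension_norm_eq (LinearMap.range L) F₀
  refine ⟨F, fun v => ?_⟩
  have h1 := hF (L.rangeRestrict v)
  -- By the domination `g` vanishes on the kernel of `L`, so the choice of the section `s` is
  -- immaterial.
  have h2 := h (s (L.rangeRestrict v) - v)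
  rw [map_sub L, hs', LinearMap.codRestrict_apply, sub_self, norm_zero, mul_zero, map_sub,
    norm_le_zero_iff, sub_eq_zero] at h2
  rw [← h2]
  exact h1

end Basics

end VNLiminf

namespace VNLiminf

/-! ### The trace and the conditional expectation -/

section Trace

variable {H : Type*} [NormedAddCommGroup H] [InnerProductSpace ℂ H] [CompleteSpace H]
  {M N : VonNeumannAlgebra H} {ω : H}

theorem inner_star_apply (x : H →L[ℂ] H) (v w : H) :
    inner ℂ (star x v) w = inner ℂ v (x w) := by
  rw [ContinuousLinearMap.star_eq_adjoint, ContinuousLinearMap.adjoint_inner_left]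

theorem inner_apply_star (x : H →L[ℂ] H) (v w : H) :
    inner ℂ v (star x w) = inner ℂ (x v) w := by
  rw [ContinuousLinearMap.star_eq_adjoint, ContinuousLinearMap.adjoint_inner_right]

theorem space_mono (hN : N ≤ M) : space N ≤ space M := fun _ hx => hN hx

namespace IsStandardForm

variable (hω : IsStandardForm M ω)

include hω

theorem trace_mul_comm {x y : H →L[ℂ] H} (hx : x ∈ M) (hy : y ∈ M) :
    inner ℂ ω (x (y ω)) = inner ℂ ω (y (x ω)) := hω.2.2 x hx y hy

theorem norm_star_apply {x : H →L[ℂ] H} (hx : x ∈ M) : ‖star x ω‖ = ‖x ω‖ := by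
  have h : (inner ℂ (star x ω) (star x ω) : ℂ) = inner ℂ (x ω) (x ω) := by
    rw [inner_star_apply, ← inner_apply_star, hω.trace_mul_comm hx (star_mem hx)]
  rw [inner_self_eq_norm_sq_to_K, inner_self_eq_norm_sq_to_K] at h
  have h' : ‖star x ω‖ ^ 2 = ‖x ω‖ ^ 2 := by exact_mod_cast h
  exact (sq_eq_sq₀ (norm_nonneg _) (norm_nonneg _)).1 h'

/-- The trace vector is separating. -/
theorem eq_zero_of_apply_eq_zero {x : H →L[ℂ] H} (hx : x ∈ M) (h : x ω = 0) : x = 0 := by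
  have h1 : ∀ v ∈ {v : H | ∃ m ∈ M, v = m ω}, x v = 0 := by
    rintro _ ⟨m, hm, rfl⟩
    -- Traciality makes `star` isometric on `Mω`; applied to `x` and then to `x m`, it turns `x ω =
    -- 0` into `x (m ω) = 0`.
    have h2 : star x ω = 0 := by rw [← norm_eq_zero, hω.norm_star_apply hx, h, norm_zero]
    have h3 := hω.norm_star_apply (mul_mem hx hm)
    rw [star_mul, mul_apply_eq_comp, h2, map_zero, norm_zero] at h3
    exact norm_eq_zero.1 h3.symm
  ext v
  exact congrFun (Continuous.ext_on hω.2.1 x.continuous continuous_const h1) v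

/-- Testing against `y = star (z - z')` gives `‖(z - z') ω‖ = 0`, and `ω` is separating. -/
theorem eq_of_trace_mul_eq (hN : N ≤ M) {z z' : H →L[ℂ] H} (hz : z ∈ N) (hz' : z' ∈ N)
    (h : ∀ y ∈ N, inner ℂ ω (z (y ω)) = inner ℂ ω (z' (y ω))) : z = z' := by
  have hd : z - z' ∈ N := sub_mem hz hz'
  rw [← sub_eq_zero]
  refine hω.eq_zero_of_apply_eq_zero (hN hd) ?_
  have h1 := h _ (star_mem hd)
  rw [← sub_eq_zero, ← inner_sub_right, ← sub_apply,
    hω.trace_mul_comm (hN hd) (hN (star_mem hd)), inner_apply_star, inner_self_eq_zero] at h1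
  exact h1

/-- A functional `τ(· y)` is a vector functional given by vectors controlled by its norm. -/
theorem exists_vector_rep (hN : N ≤ M) {y : H →L[ℂ] H} (hy : y ∈ N) {δ : ℝ} (hδ : 0 < δ)
    (h : ∀ x ∈ N, ‖inner ℂ ω (x (y ω))‖ ≤ δ * ‖x‖) :
    ∃ ζ η : H, ‖ζ‖ ^ 2 ≤ 2 * δ ∧ ‖η‖ ^ 2 ≤ 2 * δ ∧
      ∀ x ∈ M, inner ℂ ω (x (y ω)) = inner ℂ ζ (x η) := by
  obtain ⟨u, hu, k, hk, hks, hu1, huk, hε⟩ := exists_approx_polar hy hδ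
  have h1 : ‖k ω‖ ^ 2 ≤ 2 * δ := by
    -- `‖k ω‖² = τ(k²)` differs from `τ(u* y)` by at most `δ`, the tolerance of the polar
    -- decomposition, and `|τ(u* y)| ≤ δ` by hypothesis; hence the bound `2δ`.
    have h2 : (inner ℂ ω ((star u * y) ω) : ℂ) - inner ℂ ω ((star u * y - k * k) ω) =
        ((‖k ω‖ ^ 2 : ℝ) : ℂ) := by
      rw [← inner_sub_right, ← sub_apply, sub_sub_cancel, mul_apply_eq_comp]
      nth_rw 1 [← hks]
      rw [inner_apply_star, inner_self_eq_norm_sq_to_K]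
      push_cast; rfl
    have h3 := norm_sub_le (inner ℂ ω ((star u * y) ω) : ℂ)
      (inner ℂ ω ((star u * y - k * k) ω))
    rw [h2, Complex.norm_of_nonneg (by positivity)] at h3
    have h4 := h _ (star_mem hu)
    have h5 := norm_inner_apply_le (star u * y - k * k) ω ω
    rw [hω.1] at h5
    rw [norm_star] at h4
    rw [mul_apply_eq_comp] at h3
    nlinarith
  have hη : ‖u (k ω)‖ ≤ ‖k ω‖ :=
    (u.le_of_opNorm_le hu1 _).trans (one_mul _).le
  refine ⟨k ω, u (k ω), h1, le_trans (by gcongr) h1, fun x hx => ?_⟩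
  -- `τ(x u k k) = τ(k x u k) = ⟨kω, x u kω⟩`.
  have h6 := hω.trace_mul_comm (mul_mem (mul_mem hx (hN hu)) (hN hk)) (hN hk)
  rw [huk]
  nth_rw 1 [← hks] at h6
  nth_rw 3 [← hks] at h6
  simp only [mul_apply_eq_comp, inner_apply_star] at h6 ⊢
  rw [hks] at h6
  exact h6

/-- The functional `y ↦ τ(xy)` on `N` is bounded for the norm of `τ(· y)` in the dual of `N`:
writing `τ(· y)` as a vector functional with controlled vectors, a formula valid on all of `M`,
bounds `τ(xy)`. Hahn-Banach extends it to the dual of `N`, where it acts on vector functionals as an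
element of `N`. The constant `2` is harmless, as only boundedness is needed here. -/
theorem exists_condExp (hN : N ≤ M) (x : space M) :
    ∃ z : space N, ∀ y ∈ N, inner ℂ ω ((z : H →L[ℂ] H) (y ω)) =
      inner ℂ ω ((x : H →L[ℂ] H) (y ω)) := by
  let L : space N →ₗ[ℂ] BoundedDual N :=
    { toFun := fun y => vecFunctional N ω ((y : H →L[ℂ] H) ω)
      map_add' := fun a b => BoundedDual.toLin_injective <| LinearMap.ext fun x => by
        simp [vecFunctional_apply]
      map_smul' := fun c a => BoundedDual.toLin_injective <| LinearMap.ext fun x => by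
        simp [vecFunctional_apply] }
  let g : space N →ₗ[ℂ] ℂ :=
    { toFun := fun y => inner ℂ ω ((x : H →L[ℂ] H) ((y : H →L[ℂ] H) ω))
      map_add' := fun a b => by simp
      map_smul' := fun c a => by simp }
  obtain ⟨F, hF⟩ := exists_dual_comp_eq L g (2 * ‖(x : H →L[ℂ] H)‖) fun y => by
    -- The added `ε` keeps `δ` positive, as the approximate polar decomposition requires, even when
    -- `L y = 0`.
    have h1 : ∀ ε > 0, ‖g y‖ ≤ 2 * ‖(x : H →L[ℂ] H)‖ * (‖L y‖ + ε) := fun ε hε => by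
      obtain ⟨ζ, η, hζ, hη, h2⟩ := hω.exists_vector_rep hN y.2 (δ := ‖L y‖ + ε) (by positivity)
        fun z hz => ((L y).norm_toLin_apply_le ⟨z, hz⟩).trans (by gcongr; linarith)
      rw [show g y = _ from h2 x x.2]
      refine (norm_inner_apply_le (x : H →L[ℂ] H) ζ η).trans ?_
      have h3 : ‖ζ‖ * ‖η‖ ≤ 2 * (‖L y‖ + ε) := by nlinarith [sq_nonneg (‖ζ‖ - ‖η‖)]
      nlinarith [norm_nonneg (x : H →L[ℂ] H)]
    refine le_of_forall_pos_le_add fun ε hε => ?_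
    refine (h1 (ε / (2 * ‖(x : H →L[ℂ] H)‖ + 1)) (by positivity)).trans ?_
    rw [mul_add]
    gcongr
    rw [mul_div_assoc', div_le_iff₀ (by positivity)]
    nlinarith [norm_nonneg (x : H →L[ℂ] H)]
  obtain ⟨z, hz, -⟩ := exists_eval_of_dual N F
  exact ⟨z, fun y hy => (hz _ _).symm.trans (hF ⟨y, hy⟩)⟩

end IsStandardForm

/-- The trace preserving conditional expectation of `M` onto a von Neumann subalgebra `N`. -/
noncomputable def condExp (hω : IsStandardForm M ω) (hN : N ≤ M) : space M →ₗ[ℂ] space N where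
  toFun x := (hω.exists_condExp hN x).choose
  map_add' a b := by
    refine Subtype.ext (hω.eq_of_trace_mul_eq hN (Subtype.prop _) (Subtype.prop _)
      fun y hy => ?_)
    refine ((hω.exists_condExp hN (a + b)).choose_spec y hy).trans ?_
    simp only [Submodule.coe_add, add_apply, inner_add_right,
      (hω.exists_condExp hN a).choose_spec y hy, (hω.exists_condExp hN b).choose_spec y hy]
  map_smul' c a := by
    refine Subtype.ext (hω.eq_of_trace_mul_eq hN (Subtype.prop _) (Subtype.prop _)
      fun y hy => ?_)
    refine ((hω.exists_condExp hN (c • a)).choose_spec y hy).trans ?_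
    simp only [Submodule.coe_smul, smul_apply, inner_smul_right, RingHom.id_apply,
      (hω.exists_condExp hN a).choose_spec y hy]

instance (N : VonNeumannAlgebra H) (ω : H) : CompleteSpace (L2 N ω) :=
  (Submodule.isClosed_topologicalClosure _).completeSpace_coe

section CondExp

variable (hω : IsStandardForm M ω) (hN : N ≤ M)

theorem trace_condExp_mul (x : space M) {y : H →L[ℂ] H} (hy : y ∈ N) :
    inner ℂ ω ((condExp hω hN x : H →L[ℂ] H) (y ω)) =
      inner ℂ ω ((x : H →L[ℂ] H) (y ω)) :=
  (hω.exists_condExp hN x).choose_spec y hy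

/-- Traciality moves `a` to the other side: both inner products become traces against `b a* ∈ N`. -/
theorem inner_condExp (x : space M) {a b : H →L[ℂ] H} (ha : a ∈ N) (hb : b ∈ N) :
    inner ℂ (a ω) ((condExp hω hN x : H →L[ℂ] H) (b ω)) =
      inner ℂ (a ω) ((x : H →L[ℂ] H) (b ω)) := by
  have h1 := hω.trace_mul_comm (hN (star_mem ha))
    (mul_mem (hN (condExp hω hN x).2) (hN hb))
  have h2 := hω.trace_mul_comm (hN (star_mem ha)) (mul_mem x.2 (hN hb))
  rw [inner_apply_star] at h1 h2
  have h3 := trace_condExp_mul hω hN x (mul_mem hb (star_mem ha))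
  simp only [mul_apply_eq_comp] at h1 h2 h3
  rw [h1, h2, h3]

theorem condExp_unique (x : space M) {z : H →L[ℂ] H} (hz : z ∈ N)
    (h : ∀ y ∈ N, inner ℂ ω (z (y ω)) = inner ℂ ω ((x : H →L[ℂ] H) (y ω))) :
    (condExp hω hN x : H →L[ℂ] H) = z :=
  hω.eq_of_trace_mul_eq hN (condExp hω hN x).2 hz fun y hy => by
    rw [trace_condExp_mul hω hN x hy, h y hy]

theorem condExp_of_mem (x : space M) (hx : (x : H →L[ℂ] H) ∈ N) :
    (condExp hω hN x : H →L[ℂ] H) = x :=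
  condExp_unique hω hN x hx fun _ _ => rfl

theorem condExp_star (x y : space M) (hxy : (y : H →L[ℂ] H) = star (x : H →L[ℂ] H)) :
    (condExp hω hN y : H →L[ℂ] H) = star (condExp hω hN x : H →L[ℂ] H) := by
  refine condExp_unique hω hN y (star_mem (condExp hω hN x).2) fun b hb => ?_
  have h1 := inner_condExp hω hN x hb (one_mem N)
  rw [hxy, inner_apply_star, inner_apply_star, ← inner_conj_symm, ← inner_conj_symm (_ : H) (b ω)]
  exact congrArg _ h1

theorem mem_L2_of_mem {x : H →L[ℂ] H} (hx : x ∈ N) : x ω ∈ L2 N ω := apply_mem_L2 N ω ⟨x, hx⟩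

theorem L2_induction {p : H → Prop} (hp : IsClosed {v | p v}) (h : ∀ x ∈ N, p (x ω)) {v : H}
    (hv : v ∈ L2 N ω) : p v := by
  refine closure_minimal (s := ((space N).map
    (ContinuousLinearMap.apply ℂ H ω).toLinearMap : Set H)) ?_ hp hv
  rintro _ ⟨x, hx, rfl⟩
  exact h x hx

/-- The conditional expectation acts on `L²(N)` as the compression. -/
theorem condExp_apply_of_mem_L2 (x : space M) {v : H} (hv : v ∈ L2 N ω) :
    (condExp hω hN x : H →L[ℂ] H) v = (L2 N ω).starProjection ((x : H →L[ℂ] H) v) := by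
  refine L2_induction (p := fun v => (condExp hω hN x : H →L[ℂ] H) v =
      (L2 N ω).starProjection ((x : H →L[ℂ] H) v))
    (isClosed_eq (by fun_prop) (by fun_prop)) (fun b hb => ?_) hv
  symm
  refine Submodule.eq_starProjection_of_mem_of_inner_eq_zero
    (mem_L2_of_mem (mul_mem (condExp hω hN x).2 hb)) fun w hw => ?_
  refine L2_induction (p := fun w => inner ℂ (_ : H) w = 0)
    (isClosed_eq (by fun_prop) (by fun_prop)) (fun a ha => ?_) hw
  rw [← inner_conj_symm, inner_sub_right, inner_condExp hω hN x ha hb,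
    sub_self, map_zero]

theorem condExp_apply_trace_vector (x : space M) :
    (condExp hω hN x : H →L[ℂ] H) ω = (L2 N ω).starProjection ((x : H →L[ℂ] H) ω) :=
  condExp_apply_of_mem_L2 hω hN x (mem_L2_of_mem (one_mem N))

end CondExp

end Trace

end VNLiminf

namespace VNLiminf

/-! ### Matrices over a von Neumann algebra and complete positivity of the expectation -/

section Matrices

variable {H : Type*} [NormedAddCommGroup H] [InnerProductSpace ℂ H]

/-- The embedding of `H` as the `j`-th summand of `Hⁿ`. -/
noncomputable def embedAt {n : ℕ} (j : Fin n) : H →L[ℂ] PiLp 2 (fun _ : Fin n => H) :=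
  ((PiLp.continuousLinearEquiv 2 ℂ (fun _ : Fin n => H)).symm :
      (Fin n → H) →L[ℂ] PiLp 2 (fun _ : Fin n => H)) ∘L
    ContinuousLinearMap.single ℂ (fun _ : Fin n => H) j

theorem embedAt_apply {n : ℕ} (j : Fin n) (v : H) (i : Fin n) :
    embedAt j v i = if i = j then v else 0 := by
  simp [embedAt]

theorem sum_embedAt {n : ℕ} (v : PiLp 2 (fun _ : Fin n => H)) : ∑ j, embedAt j (v j) = v := by
  ext i
  simp [embedAt_apply]

theorem matOp_embedAt {n : ℕ} (a : Fin n → Fin n → (H →L[ℂ] H)) (i j : Fin n) (v : H) :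
    matOp a (embedAt j v) i = a i j v := by
  rw [matOp_apply, Finset.sum_eq_single j]
  · simp [embedAt_apply]
  · intro k _ hk
    simp [embedAt_apply, hk]
  · simp

theorem matOp_injective {n : ℕ} {a b : Fin n → Fin n → (H →L[ℂ] H)} (h : matOp a = matOp b)
    (i j : Fin n) : a i j = b i j := by
  ext v
  rw [← matOp_embedAt a, h, matOp_embedAt]

theorem inner_matOp {n : ℕ} (a : Fin n → Fin n → (H →L[ℂ] H))
    (v w : PiLp 2 (fun _ : Fin n => H)) :
    inner ℂ v (matOp a w) = ∑ i, ∑ j, inner ℂ (v i) (a i j (w j)) := by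
  simp [PiLp.inner_apply, matOp_apply, inner_sum]

/-- The entries of an operator on `Hⁿ`. -/
noncomputable def entry {n : ℕ}
    (S : PiLp 2 (fun _ : Fin n => H) →L[ℂ] PiLp 2 (fun _ : Fin n => H)) (i j : Fin n) :
    H →L[ℂ] H :=
  PiLp.proj 2 (fun _ : Fin n => H) i ∘L S ∘L embedAt j

theorem entry_apply {n : ℕ}
    (S : PiLp 2 (fun _ : Fin n => H) →L[ℂ] PiLp 2 (fun _ : Fin n => H)) (i j : Fin n) (v : H) :
    entry S i j v = S (embedAt j v) i := rfl

/-- The diagonal operator on `Hⁿ`. -/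
noncomputable def diagOp (n : ℕ) (r : H →L[ℂ] H) :
    PiLp 2 (fun _ : Fin n => H) →L[ℂ] PiLp 2 (fun _ : Fin n => H) :=
  matOp fun i j => if i = j then r else 0

theorem diagOp_apply {n : ℕ} (r : H →L[ℂ] H) (v : PiLp 2 (fun _ : Fin n => H)) (i : Fin n) :
    diagOp n r v i = r (v i) := by
  rw [diagOp, matOp_apply, Finset.sum_eq_single i]
  · simp
  · intro j _ hj
    simp [hj.symm]
  · simp

theorem diagOp_embedAt {n : ℕ} (r : H →L[ℂ] H) (j : Fin n) (v : H) :
    diagOp n r (embedAt j v) = embedAt j (r v) := by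
  ext i
  rw [diagOp_apply, embedAt_apply, embedAt_apply]
  split_ifs <;> simp

variable [CompleteSpace H]

theorem star_matOp {n : ℕ} (a : Fin n → Fin n → (H →L[ℂ] H)) :
    star (matOp a) = matOp fun i j => star (a j i) := by
  symm
  rw [ContinuousLinearMap.star_eq_adjoint, ContinuousLinearMap.eq_adjoint_iff]
  intro v w
  rw [inner_matOp, ← inner_conj_symm, inner_matOp, map_sum, Finset.sum_comm]
  simp only [map_sum, inner_conj_symm, inner_star_apply]

theorem commute_matOp_diagOp {N : VonNeumannAlgebra H} {n : ℕ}
    {a : Fin n → Fin n → (H →L[ℂ] H)} (ha : ∀ i j, a i j ∈ N) {r : H →L[ℂ] H}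
    (hr : r ∈ N.commutant) : Commute (matOp a) (diagOp n r) := by
  ext v i
  simp only [mul_apply_eq_comp, matOp_apply, diagOp_apply, map_sum]
  exact Finset.sum_congr rfl fun j _ =>
    DFunLike.congr_fun (commute_of_mem_commutant (ha i j) hr).eq (v j)

/-- This is the identification of `Mₙ(N)` with the commutant of the diagonal copy of `N'`; it shows
that functional calculus of a matrix over `N` again has entries in `N`. -/
theorem entry_mem {N : VonNeumannAlgebra H} {n : ℕ}
    {S : PiLp 2 (fun _ : Fin n => H) →L[ℂ] PiLp 2 (fun _ : Fin n => H)}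
    (h : ∀ r ∈ N.commutant, Commute S (diagOp n r)) (i j : Fin n) : entry S i j ∈ N := by
  refine mem_of_commute_commutant fun r hr => ?_
  ext v
  rw [mul_apply_eq_comp, mul_apply_eq_comp, entry_apply, entry_apply, ← diagOp_embedAt,
    ← diagOp_apply, ← mul_apply_eq_comp, ← mul_apply_eq_comp, (h r hr).eq]

variable {M N : VonNeumannAlgebra H} {ω : H}

/-- Positivity of a selfadjoint matrix over `N` can be tested on vectors of `L²(N)`. -/
theorem isPositive_of_L2 (hω : IsStandardForm M ω) (hN : N ≤ M) {n : ℕ}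
    {T : PiLp 2 (fun _ : Fin n => H) →L[ℂ] PiLp 2 (fun _ : Fin n => H)} (hT : IsSelfAdjoint T)
    (hc : ∀ r ∈ N.commutant, Commute T (diagOp n r))
    (hp : ∀ v : PiLp 2 (fun _ : Fin n => H), (∀ i, v i ∈ L2 N ω) →
      0 ≤ (inner ℂ v (T v)).re) : T.IsPositive := by
  -- `S = q(T)` is the negative part of `T` and `R` its square root, so `R T R = -S²`. The columns
  -- of `R` applied to `ω` lie in `L2 N ω`; testing there forces `S` to kill every `embedAt j ω`,
  -- and since `ω` is separating, `S = 0`.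
  let q : ℝ → ℝ := fun t => max (-t) 0
  have hq0 : ∀ t, 0 ≤ q t := fun t => le_max_right _ _
  have hqc : Continuous q := by fun_prop
  have hsc : Continuous fun t => √(q t) := by fun_prop
  have hmc : Continuous fun t => t * √(q t) := by fun_prop
  have hid : cfc (fun t : ℝ => t) T = T := cfc_id ℝ T
  set R := cfc (fun t => √(q t)) T with hR
  set S := cfc q T with hS
  have hRs : star R = R := (cfc_predicate (fun t => √(q t)) T : IsSelfAdjoint _)
  have hSs : star S = S := (cfc_predicate q T : IsSelfAdjoint _)
  have hRTR : R * (T * R) = -(S * S) := by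
    rw [hS, ← cfc_mul q q T hqc.continuousOn hqc.continuousOn, ← cfc_neg]
    have hTR : T * R = cfc (fun t => t * √(q t)) T := by
      rw [cfc_mul _ _ T (continuous_id' (X := ℝ)).continuousOn hsc.continuousOn, hid]
    rw [hTR, hR, ← cfc_mul _ _ T hsc.continuousOn hmc.continuousOn]
    refine cfc_congr fun t _ => ?_
    have h1 := Real.mul_self_sqrt (hq0 t)
    have h2 : t * q t = -(q t * q t) := by
      rcases le_total t 0 with h | h
      · simp only [q, max_eq_left (neg_nonneg.2 h)]; ring
      · simp only [q, max_eq_right (neg_nonpos.2 h)]; ring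
    linear_combination t * h1 + h2
  have hSω : ∀ j, S (embedAt j ω) = 0 := fun j => by
    have h1 := hp (R (embedAt j ω)) fun i =>
      mem_L2_of_mem (entry_mem (fun r hr => (hc r hr).cfc_real _) i j)
    nth_rw 1 [← hRs] at h1
    rw [inner_star_apply, ← mul_apply_eq_comp, ← mul_apply_eq_comp, mul_assoc, hRTR, neg_apply,
      mul_apply_eq_comp] at h1
    nth_rw 1 [← hSs] at h1
    rw [inner_neg_right, inner_apply_star, Complex.neg_re] at h1
    have h2 : ‖S (embedAt j ω)‖ ^ 2 ≤ 0 := by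
      have : (inner ℂ (S (embedAt j ω)) (S (embedAt j ω))).re = ‖S (embedAt j ω)‖ ^ 2 :=
        inner_self_eq_norm_sq (𝕜 := ℂ) _
      linarith
    exact norm_eq_zero.1 (pow_eq_zero_iff two_ne_zero |>.1 (le_antisymm h2 (by positivity)))
  have hS0 : S = 0 := by
    have h1 : ∀ i j, entry S i j = 0 := fun i j =>
      hω.eq_zero_of_apply_eq_zero (hN (entry_mem (fun r hr => (hc r hr).cfc_real _) i j))
        (by rw [entry_apply, hSω]; rfl)
    ext v i
    conv_lhs => rw [← sum_embedAt v]
    rw [map_sum]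
    simp only [WithLp.ofLp_sum, Finset.sum_apply, ← entry_apply, h1]
    simp
  rw [← ContinuousLinearMap.nonneg_iff_isPositive]
  have h1 : T = cfc (fun t => t + q t) T := by
    rw [cfc_add T (fun t => t) q (continuous_id' (X := ℝ)).continuousOn hqc.continuousOn, hid,
      ← hS, hS0, add_zero]
  rw [h1]
  exact cfc_nonneg fun t _ => by
    have : -t ≤ q t := le_max_left _ _
    linarith

theorem matOp_condExp_apply (hω : IsStandardForm M ω) (hN : N ≤ M) {n : ℕ}
    (a : Fin n → Fin n → space M) {v : PiLp 2 (fun _ : Fin n => H)} (hv : ∀ i, v i ∈ L2 N ω)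
    (i : Fin n) :
    matOp (fun i j => (condExp hω hN (a i j) : H →L[ℂ] H)) v i =
      (L2 N ω).starProjection (matOp (fun i j => (a i j : H →L[ℂ] H)) v i) := by
  rw [matOp_apply, matOp_apply, map_sum]
  exact Finset.sum_congr rfl fun j _ => condExp_apply_of_mem_L2 hω hN _ (hv j)

theorem isUCP_condExp (hω : IsStandardForm M ω) (hN : N ≤ M) :
    IsUCP ((space N).subtype ∘ₗ condExp hω hN) := by
  refine ⟨fun n a ha => ?_, fun x hx => ?_⟩
  · refine isPositive_of_L2 hω hN ?_ (fun r hr =>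
      commute_matOp_diagOp (fun i j => (condExp hω hN (a i j)).2) hr) fun v hv => ?_
    · rw [IsSelfAdjoint, star_matOp]
      have h1 := ha.isSelfAdjoint.star_eq
      rw [star_matOp] at h1
      congr 1
      funext i j
      exact (condExp_star hω hN (a j i) (a i j) (matOp_injective h1 i j).symm).symm
    · have h1 := ha.re_inner_nonneg_right v
      refine h1.trans_eq (congrArg Complex.re ?_)
      rw [PiLp.inner_apply, PiLp.inner_apply]
      refine Finset.sum_congr rfl fun i _ => ?_
      change _ = inner ℂ (v i) (matOp (fun i j => (condExp hω hN (a i j) : H →L[ℂ] H)) v i)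
      rw [matOp_condExp_apply hω hN a hv, ← Submodule.inner_starProjection_left_eq_right,
        Submodule.starProjection_eq_self_iff.2 (hv i)]
  · have h1 : (x : H →L[ℂ] H) ∈ N := by rw [hx]; exact one_mem N
    exact (condExp_of_mem hω hN x h1).trans hx

/-- The conditional expectation is completely contractive. -/
theorem norm_matOp_condExp_le (hω : IsStandardForm M ω) (hN : N ≤ M) {n : ℕ}
    (a : Fin n → Fin n → space M) :
    ‖matOp (fun i j => (condExp hω hN (a i j) : H →L[ℂ] H))‖ ≤
      ‖matOp (fun i j => (a i j : H →L[ℂ] H))‖ := by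
  set Z := matOp (fun i j => (condExp hω hN (a i j) : H →L[ℂ] H)) with hZ
  set Y := matOp (fun i j => (a i j : H →L[ℂ] H)) with hY
  have hin : ∀ v, (inner ℂ v ((((‖Y‖ ^ 2 : ℝ) : ℂ) • 1 - star Z * Z :
      PiLp 2 (fun _ : Fin n => H) →L[ℂ] PiLp 2 (fun _ : Fin n => H)) v)).re =
      ‖Y‖ ^ 2 * ‖v‖ ^ 2 - ‖Z v‖ ^ 2 := fun v => by
    rw [sub_apply, inner_sub_right, mul_apply_eq_comp, inner_apply_star, smul_apply,
      inner_smul_right, one_apply_eq_self, Complex.sub_re, Complex.re_ofReal_mul]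
    exact congrArg₂ (fun s t => ‖Y‖ ^ 2 * s - t) (inner_self_eq_norm_sq (𝕜 := ℂ) v)
      (inner_self_eq_norm_sq (𝕜 := ℂ) (Z v))
  -- On vectors with entries in `L2 N ω`, `Z` is the projection of `Y`, so `‖Z v‖ ≤ ‖Y v‖` there;
  -- the positivity test carries `Z* Z ≤ ‖Y‖²` to the whole space.
  have hpos : (((‖Y‖ ^ 2 : ℝ) : ℂ) • 1 - star Z * Z).IsPositive := by
    refine isPositive_of_L2 hω hN ?_ (fun r hr => ?_) fun v hv => ?_
    · refine IsSelfAdjoint.sub (R := _ →L[ℂ] _) ?_ (IsSelfAdjoint.star_mul_self Z)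
      rw [IsSelfAdjoint, star_smul, star_one, Complex.star_def, Complex.conj_ofReal]
    · refine ((Commute.one_left _).smul_left _).sub_left (Commute.mul_left ?_ ?_)
      · rw [hZ, star_matOp]
        exact commute_matOp_diagOp (fun i j => star_mem (condExp hω hN (a j i)).2) hr
      · exact commute_matOp_diagOp (fun i j => (condExp hω hN (a i j)).2) hr
    · rw [hin]
      have h1 : ‖Z v‖ ≤ ‖Y v‖ := by
        refine (sq_le_sq₀ (norm_nonneg _) (norm_nonneg _)).1 ?_
        rw [PiLp.norm_sq_eq_of_L2, PiLp.norm_sq_eq_of_L2]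
        gcongr with i
        rw [hZ, matOp_condExp_apply hω hN a hv]
        exact Submodule.norm_starProjection_apply_le _ _
      have h2 := h1.trans (Y.le_opNorm v)
      have := mul_self_le_mul_self (norm_nonneg _) h2
      nlinarith
  refine ContinuousLinearMap.opNorm_le_bound _ (norm_nonneg _) fun v => ?_
  have h1 := hpos.re_inner_nonneg_right v
  have h2 : ‖Z v‖ ^ 2 ≤ (‖Y‖ * ‖v‖) ^ 2 := by
    have := hin v
    rw [mul_pow]
    change 0 ≤ Complex.re _ at h1
    linarith
  exact (sq_le_sq₀ (norm_nonneg _) (by positivity)).1 h2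

end Matrices

end VNLiminf

namespace VNLiminf

/-! ### Unital completely positive maps and the Kadison-Schwarz inequality -/

section CompletelyPositive

variable {H : Type*} [NormedAddCommGroup H] [InnerProductSpace ℂ H]
  {K : Type*} [NormedAddCommGroup K] [InnerProductSpace ℂ K]
  {L : Type*} [NormedAddCommGroup L] [InnerProductSpace ℂ L]

theorem IsUCP.comp {X : Submodule ℂ (H →L[ℂ] H)} {Y : Submodule ℂ (K →L[ℂ] K)}
    {φ : X →ₗ[ℂ] Y} {ψ : Y →ₗ[ℂ] (L →L[ℂ] L)} (hψ : IsUCP ψ) (hφ : IsUCP (Y.subtype ∘ₗ φ)) :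
    IsUCP (ψ ∘ₗ φ) :=
  ⟨fun n a ha => hψ.1 n (fun i j => φ (a i j)) (hφ.1 n a ha),
    fun x hx => hψ.2 (φ x) (hφ.2 x hx)⟩

theorem IsUCP.comp_inclusion {X Y : Submodule ℂ (H →L[ℂ] H)} (h : X ≤ Y)
    {ψ : Y →ₗ[ℂ] (L →L[ℂ] L)} (hψ : IsUCP ψ) : IsUCP (ψ ∘ₗ Submodule.inclusion h) :=
  ⟨fun n a ha => hψ.1 n (fun i j => Submodule.inclusion h (a i j)) ha,
    fun x hx => hψ.2 (Submodule.inclusion h x) hx⟩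

/-- The quadratic form is `‖v₀ + x v₁‖² + (⟨v₁, z v₁⟩ - ‖x v₁‖²)`. A majorant `z` stands in for `x*
x`, which need not belong to an operator system containing `x`. -/
theorem isPositive_matOp_two [CompleteSpace H] {x z : H →L[ℂ] H} (hz : IsSelfAdjoint z)
    (h : ∀ v, ‖x v‖ ^ 2 ≤ (inner ℂ v (z v)).re) :
    (matOp ![![1, x], ![star x, z]]).IsPositive := by
  rw [ContinuousLinearMap.isPositive_def']
  refine ⟨?_, fun v => ?_⟩
  · rw [IsSelfAdjoint, star_matOp]
    congr 1
    funext i j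
    fin_cases i <;> fin_cases j <;> simp [hz.star_eq]
  · rw [ContinuousLinearMap.reApplyInnerSelf_apply, ← inner_conj_symm, inner_matOp]
    have h1 := h (v 1)
    have h2 := norm_add_sq (𝕜 := ℂ) (v 0) (x (v 1))
    have h3 : (inner ℂ (v 1) (star x (v 0))).re = (inner ℂ (v 0) (x (v 1))).re := by
      rw [inner_apply_star, ← inner_conj_symm, Complex.conj_re]
    have h4 : (inner ℂ (v 0) (v 0)).re = ‖v 0‖ ^ 2 := inner_self_eq_norm_sq (𝕜 := ℂ) _
    simp only [RCLike.re_to_complex] at h2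
    simp only [Fin.sum_univ_two, Matrix.cons_val_zero, Matrix.cons_val_one,
      one_apply_eq_self, RCLike.re_to_complex, Complex.conj_re, Complex.add_re, h3, h4]
    nlinarith [sq_nonneg ‖v 0 + x (v 1)‖]

theorem norm_sq_le_of_isPositive_matOp_two {b b' c : H →L[ℂ] H}
    (h : (matOp ![![1, b], ![b', c]]).IsPositive) (v : H) :
    ‖b v‖ ^ 2 ≤ (inner ℂ v (c v)).re := by
  have h1 : ∀ w, inner ℂ (b v) w = inner ℂ v (b' w) := fun w => by
    have := h.isSymmetric (embedAt 1 v) (embedAt 0 w)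
    simpa [PiLp.inner_apply, matOp_embedAt, embedAt_apply] using this
  -- The vector `(-b v, v)` minimizes the form over its first coordinate, leaving `⟨v, c v⟩ - ‖b
  -- v‖²`.
  have h2 := h.re_inner_nonneg_right (embedAt 1 v - embedAt 0 (b v))
  rw [inner_matOp] at h2
  have h3 : (inner ℂ (b v) (b v)).re = ‖b v‖ ^ 2 := inner_self_eq_norm_sq (𝕜 := ℂ) _
  simp only [Fin.sum_univ_two, Matrix.cons_val_zero, Matrix.cons_val_one, one_apply_eq_self,
    RCLike.re_to_complex, Complex.add_re, PiLp.sub_apply, embedAt_apply, ← h1, map_neg,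
    inner_neg_left, inner_neg_right, if_true, zero_sub, sub_zero, Complex.neg_re, h3,
    one_ne_zero, zero_ne_one, if_false] at h2
  linarith

theorem re_inner_ofReal_smul_one (r : ℝ) (v : H) :
    (inner ℂ v (((r : ℂ) • (1 : H →L[ℂ] H)) v)).re = r * ‖v‖ ^ 2 := by
  rw [smul_apply, one_apply_eq_self, inner_smul_right, Complex.re_ofReal_mul]
  exact congrArg _ (inner_self_eq_norm_sq (𝕜 := ℂ) v)

variable [CompleteSpace H] {X : Submodule ℂ (H →L[ℂ] H)} {φ : X →ₗ[ℂ] (K →L[ℂ] K)}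

/-- The Kadison-Schwarz inequality. -/
theorem IsUCP.kadison_schwarz (hφ : IsUCP φ) (h1 : 1 ∈ X) {x y z : X}
    (hy : (y : H →L[ℂ] H) = star (x : H →L[ℂ] H)) (hz : IsSelfAdjoint (z : H →L[ℂ] H))
    (h : ∀ v, ‖(x : H →L[ℂ] H) v‖ ^ 2 ≤ (inner ℂ v ((z : H →L[ℂ] H) v)).re) (v : K) :
    ‖φ x v‖ ^ 2 ≤ (inner ℂ v (φ z v)).re := by
  refine norm_sq_le_of_isPositive_matOp_two (b' := φ y) ?_ v
  have h2 := hφ.1 2 ![![⟨1, h1⟩, x], ![y, z]] ?_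
  · convert h2 using 2
    funext i j
    fin_cases i <;> fin_cases j <;> simp [hφ.2 ⟨1, h1⟩ rfl]
  · convert isPositive_matOp_two hz h using 2
    funext i j
    fin_cases i <;> fin_cases j <;> simp [hy]

/-- Kadison-Schwarz with the majorant `z = ‖x‖² • 1`, which is always available in an operator
system. -/
theorem IsUCP.norm_apply_le (hφ : IsUCP φ) (h1 : 1 ∈ X) {x : X}
    (hx : star (x : H →L[ℂ] H) ∈ X) : ‖φ x‖ ≤ ‖(x : H →L[ℂ] H)‖ := by
  refine ContinuousLinearMap.opNorm_le_bound _ (norm_nonneg _) fun v => ?_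
  have h2 := hφ.kadison_schwarz h1 (x := x) (y := ⟨_, hx⟩)
    (z := ((‖(x : H →L[ℂ] H)‖ ^ 2 : ℝ) : ℂ) • ⟨1, h1⟩) rfl ?_ (fun v => ?_) v
  · rw [map_smul, hφ.2 ⟨1, h1⟩ rfl, re_inner_ofReal_smul_one, ← mul_pow] at h2
    exact (sq_le_sq₀ (norm_nonneg _) (by positivity)).1 h2
  · rw [Submodule.coe_smul, IsSelfAdjoint, star_smul, star_one, Complex.star_def,
      Complex.conj_ofReal]
  · refine le_of_le_of_eq ?_ (re_inner_ofReal_smul_one _ v).symm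
    rw [← mul_pow]
    exact (sq_le_sq₀ (norm_nonneg _) (by positivity)).2 (ContinuousLinearMap.le_opNorm _ _)

end CompletelyPositive

/-! ### Normality of the conditional expectation -/

section Normality

variable {H : Type*} [NormedAddCommGroup H] [InnerProductSpace ℂ H] [CompleteSpace H]
  {M N : VonNeumannAlgebra H} {ω : H}

theorem norm_condExp_le (hω : IsStandardForm M ω) (hN : N ≤ M) (x : space M) :
    ‖(condExp hω hN x : H →L[ℂ] H)‖ ≤ ‖(x : H →L[ℂ] H)‖ :=
  (isUCP_condExp hω hN).norm_apply_le (one_mem M) (show star (x : H →L[ℂ] H) ∈ M from star_mem x.2)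

/-- A functional on `M` that is a norm limit of functionals `τ(· y)` is normal. -/
theorem mem_predual_of_approx (hω : IsStandardForm M ω) {f : space M →ₗ[ℂ] ℂ}
    (h : ∀ ε > 0, ∃ y ∈ M, ∀ x : space M,
      ‖f x - inner ℂ ω ((x : H →L[ℂ] H) (y ω))‖ ≤ ε * ‖(x : H →L[ℂ] H)‖) : f ∈ predual M := by
  choose y hyM hy using fun n : ℕ => h ((1 / 4) ^ n) (by positivity)
  -- Telescoping: `s 0 = 0` and `s (n + 1) = y n`, with `δ n` bounding the norm of `τ(· (s (n + 1) -
  -- s n))`. Geometric decay makes the representing vectors square summable; the `+ 1` in `δ 0` only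
  -- ensures positivity.
  let s : ℕ → H →L[ℂ] H := fun n => Nat.casesOn n 0 y
  have hs : ∀ n, s n ∈ M := by
    rintro (_ | n)
    · exact zero_mem M
    · exact hyM n
  let δ : ℕ → ℝ := fun n => Nat.casesOn n (‖y 0‖ + 1) fun n => 2 * (1 / 4) ^ n
  have hδ : ∀ n, 0 < δ n := by
    rintro (_ | n)
    · change 0 < ‖y 0‖ + 1
      positivity
    · change 0 < 2 * (1 / 4 : ℝ) ^ n
      positivity
  have hδs : Summable fun n => 2 * δ n := by
    refine Summable.mul_left 2 ((summable_nat_add_iff 1).1 ?_)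
    exact (summable_geometric_of_lt_one (by norm_num) (by norm_num)).mul_left 2
  have hb : ∀ n, ∀ x ∈ M, ‖inner ℂ ω (x ((s (n + 1) - s n) ω))‖ ≤ δ n * ‖x‖ := by
    rintro (_ | n) x hx
    · change ‖inner ℂ ω (x ((y 0 - 0) ω))‖ ≤ (‖y 0‖ + 1) * ‖x‖
      rw [sub_zero]
      have h1 := norm_inner_apply_le (x * y 0) ω ω
      rw [hω.1] at h1
      have h2 := norm_mul_le x (y 0)
      rw [mul_apply_eq_comp] at h1
      nlinarith [norm_nonneg x]
    · change ‖inner ℂ ω (x ((y (n + 1) - y n) ω))‖ ≤ 2 * (1 / 4) ^ n * ‖x‖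
      have h1 := hy (n + 1) ⟨x, hx⟩
      have h2 := hy n ⟨x, hx⟩
      have h3 := norm_sub_le (f ⟨x, hx⟩ - inner ℂ ω (x (y n ω)))
        (f ⟨x, hx⟩ - inner ℂ ω (x (y (n + 1) ω)))
      rw [sub_sub_sub_cancel_left, ← inner_sub_right, ← map_sub, ← sub_apply] at h3
      have h4 : (1 / 4 : ℝ) ^ (n + 1) * ‖x‖ ≤ (1 / 4) ^ n * ‖x‖ := by
        gcongr ?_ * _
        exact pow_le_pow_of_le_one (by norm_num) (by norm_num) n.le_succ
      change _ ≤ _ * ‖x‖ at h1 h2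
      linarith
  choose ζ η hζ hη hrep using fun n =>
    hω.exists_vector_rep le_rfl (sub_mem (hs (n + 1)) (hs n)) (hδ n) (hb n)
  have hζs : Summable fun n => ‖ζ n‖ ^ 2 := .of_nonneg_of_le (fun _ => by positivity) hζ hδs
  have hηs : Summable fun n => ‖η n‖ ^ 2 := .of_nonneg_of_le (fun _ => by positivity) hη hδs
  refine ⟨ζ, η, hζs, hηs, fun x => ?_⟩
  have hsum : Summable fun n => inner ℂ (ζ n) ((x : H →L[ℂ] H) (η n)) :=
    Summable.of_norm_bounded ((summable_mul_of_summable_sq hζs hηs (fun _ => norm_nonneg _)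
      fun _ => norm_nonneg _).mul_left ‖(x : H →L[ℂ] H)‖) fun n => by
        simpa only [mul_assoc] using norm_inner_apply_le (x : H →L[ℂ] H) (ζ n) (η n)
  rw [hsum.hasSum_iff_tendsto_nat, ← tendsto_add_atTop_iff_nat 1]
  have h1 : ∀ n, ∑ i ∈ Finset.range (n + 1), inner ℂ (ζ i) ((x : H →L[ℂ] H) (η i)) =
      inner ℂ ω ((x : H →L[ℂ] H) (y n ω)) := fun n => by
    simp only [← hrep _ _ x.2, ← inner_sum, ← map_sum, ← sum_apply]
    rw [Finset.sum_range_sub]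
    exact congrArg (fun w : H →L[ℂ] H => inner ℂ ω ((x : H →L[ℂ] H) (w ω))) (sub_zero (y n))
  simp only [h1]
  rw [tendsto_iff_norm_sub_tendsto_zero]
  refine squeeze_zero (fun _ => norm_nonneg _)
    (fun n => (norm_sub_rev _ _).trans_le (hy n x)) ?_
  simpa using (tendsto_pow_atTop_nhds_zero_of_lt_one (r := (1 / 4 : ℝ)) (by norm_num)
    (by norm_num)).mul_const ‖(x : H →L[ℂ] H)‖

theorem continuous_vecFunctional_right (N : VonNeumannAlgebra H) (ζ : H) :
    Continuous (vecFunctional N ζ) := by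
  refine (LipschitzWith.of_dist_le_mul (K := ‖ζ‖₊) fun v w => ?_).continuous
  rw [dist_eq_norm, dist_eq_norm]
  refine le_trans (le_of_eq (congrArg norm ?_)) (norm_vecFunctional_le N ζ (v - w))
  refine BoundedDual.toLin_injective (LinearMap.ext fun x => ?_)
  simp [vecFunctional_apply]

theorem continuous_vecFunctional_left (N : VonNeumannAlgebra H) (η : H) :
    Continuous fun ζ => vecFunctional N ζ η := by
  refine (LipschitzWith.of_dist_le_mul (K := ‖η‖₊) fun v w => ?_).continuous
  rw [dist_eq_norm, dist_eq_norm]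
  refine le_trans (le_of_eq (congrArg norm ?_))
    ((norm_vecFunctional_le N (v - w) η).trans_eq (mul_comm _ _))
  refine BoundedDual.toLin_injective (LinearMap.ext fun x => ?_)
  simp [vecFunctional_apply]

/-- The functionals `τ(· y)`, `y ∈ M`, restricted to `N`, are norm dense in the predual, because
`⟨mω, x nω⟩ = τ(x n m*)` and `Mω` is dense. -/
theorem exists_approx_of_mem_predual (hω : IsStandardForm M ω) (hN : N ≤ M) {ξ : space N →ₗ[ℂ] ℂ}
    (hξ : ξ ∈ predual N) {ε : ℝ} (hε : 0 < ε) :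
    ∃ y ∈ M, ∀ x : space N,
      ‖ξ x - inner ℂ ω ((x : H →L[ℂ] H) (y ω))‖ ≤ ε * ‖(x : H →L[ℂ] H)‖ := by
  let L : space M →ₗ[ℂ] BoundedDual N :=
    { toFun := fun y => vecFunctional N ω ((y : H →L[ℂ] H) ω)
      map_add' := fun a b => BoundedDual.toLin_injective <| LinearMap.ext fun x => by
        simp [vecFunctional_apply]
      map_smul' := fun c a => BoundedDual.toLin_injective <| LinearMap.ext fun x => by
        simp [vecFunctional_apply] }
  have hcl : IsClosed ((LinearMap.range L).topologicalClosure : Set (BoundedDual N)) :=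
    Submodule.isClosed_topologicalClosure _
  have h1 : ∀ m ∈ M, ∀ n ∈ M,
      vecFunctional N (m ω) (n ω) ∈ (LinearMap.range L).topologicalClosure := by
    intro m hm n hn
    refine Submodule.le_topologicalClosure _
      ⟨⟨n * star m, show n * star m ∈ M from mul_mem hn (star_mem hm)⟩, ?_⟩
    refine BoundedDual.toLin_injective (LinearMap.ext fun x => ?_)
    have h := hω.trace_mul_comm (star_mem hm) (mul_mem (hN x.2) hn)
    rw [inner_apply_star] at h
    exact h.symm
  have h2 : ∀ m ∈ M, ∀ w, vecFunctional N (m ω) w ∈ (LinearMap.range L).topologicalClosure :=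
    fun m hm w => closure_minimal
      (by rintro _ ⟨n, hn, rfl⟩; exact h1 m hm n hn)
      (hcl.preimage (continuous_vecFunctional_right N (m ω))) (hω.2.1 w)
  have h3 : ∀ v w, vecFunctional N v w ∈ (LinearMap.range L).topologicalClosure :=
    fun v w => closure_minimal
      (by rintro _ ⟨m, hm, rfl⟩; exact h2 m hm w)
      (hcl.preimage (continuous_vecFunctional_left N w)) (hω.2.1 v)
  obtain ⟨ξ', rfl, ζ, η, hs⟩ := exists_hasSum_vecFunctional hξ
  have h4 : ξ' ∈ closure (LinearMap.range L : Set (BoundedDual N)) :=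
    hcl.mem_of_tendsto hs.tendsto_sum_nat
      (Eventually.of_forall fun n => Submodule.sum_mem _ fun i _ => h3 _ _)
  obtain ⟨_, ⟨y, rfl⟩, hy⟩ := Metric.mem_closure_iff.1 h4 ε hε
  refine ⟨y, y.2, fun x => ?_⟩
  rw [dist_eq_norm] at hy
  exact ((ξ' - L y).norm_toLin_apply_le x).trans (by gcongr)

/-- The conditional expectation is normal. -/
theorem comp_condExp_mem_predual (hω : IsStandardForm M ω) (hN : N ≤ M)
    {ξ : space N →ₗ[ℂ] ℂ} (hξ : ξ ∈ predual N) : ξ ∘ₗ condExp hω hN ∈ predual M := by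
  refine mem_predual_of_approx hω fun ε hε => ?_
  obtain ⟨y, hy, h⟩ := exists_approx_of_mem_predual hω hN hξ hε
  -- The expectation is symmetric for the trace, `τ(E(x) y) = τ(x E(y))`, so an approximation of `ξ`
  -- by `τ(· y)` gives one of `ξ ∘ E` by `τ(· E(y))`.
  refine ⟨condExp hω hN ⟨y, hy⟩, hN (condExp hω hN ⟨y, hy⟩).2, fun x => ?_⟩
  have h1 := trace_condExp_mul hω hN x (condExp hω hN ⟨y, hy⟩).2
  have h2 := trace_condExp_mul hω hN ⟨y, hy⟩ (condExp hω hN x).2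
  rw [hω.trace_mul_comm (hN (condExp hω hN ⟨y, hy⟩).2) (hN (condExp hω hN x).2), h1,
    hω.trace_mul_comm hy (hN (condExp hω hN x).2)] at h2
  rw [h2]
  exact (h (condExp hω hN x)).trans (by gcongr; exact norm_condExp_le hω hN x)

end Normality

end VNLiminf

namespace VNLiminf

/-! ### Strong convergence of orthogonal projections -/

section Projections

variable {E : Type*} [NormedAddCommGroup E] [InnerProductSpace ℂ E]

theorem tendsto_starProjection_of_mem_closure {W : ℕ → Submodule ℂ E}
    [∀ k, (W k).HasOrthogonalProjection] {S : Set E}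
    (h : ∀ v ∈ S, Tendsto (fun k => (W k).starProjection v) atTop (𝓝 v)) {v : E}
    (hv : v ∈ closure S) : Tendsto (fun k => (W k).starProjection v) atTop (𝓝 v) := by
  rw [Metric.tendsto_atTop]
  intro ε hε
  obtain ⟨s, hs, hvs⟩ := Metric.mem_closure_iff.1 hv (ε / 3) (by positivity)
  obtain ⟨n, hn⟩ := Metric.tendsto_atTop.1 (h s hs) (ε / 3) (by positivity)
  refine ⟨n, fun k hk => ?_⟩
  have h1 : dist ((W k).starProjection v) ((W k).starProjection s) ≤ dist v s := by
    rw [dist_eq_norm, dist_eq_norm, ← map_sub]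
    exact Submodule.norm_starProjection_apply_le _ _
  have h2 := hn k hk
  have h3 := dist_triangle4 ((W k).starProjection v) ((W k).starProjection s) s v
  rw [dist_comm s v] at h3
  linarith

theorem tendsto_starProjection_of_approx {W : ℕ → Submodule ℂ E}
    [∀ k, (W k).HasOrthogonalProjection] {v : E} {w : ℕ → E} (hw : ∀ k, w k ∈ W k)
    (h : Tendsto w atTop (𝓝 v)) : Tendsto (fun k => (W k).starProjection v) atTop (𝓝 v) := by
  rw [tendsto_iff_norm_sub_tendsto_zero] at h ⊢
  have h' := h.const_mul 2
  rw [mul_zero] at h'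
  refine squeeze_zero (fun _ => norm_nonneg _) (fun k => ?_) h'
  have h1 : (W k).starProjection v - v = (w k - v) - (W k).starProjection (w k - v) := by
    rw [map_sub, Submodule.starProjection_eq_self_iff.2 (hw k)]
    abel
  rw [h1]
  have h2 := norm_sub_le (w k - v) ((W k).starProjection (w k - v))
  have h3 := Submodule.norm_starProjection_apply_le (W k) (w k - v)
  linarith

end Projections

/-! ### Convergence of the conditional expectations along the limes inferior -/

section Limits

variable {H : Type*} [NormedAddCommGroup H] [InnerProductSpace ℂ H] [CompleteSpace H]
  {M N : VonNeumannAlgebra H} {ω : H}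

/-- The conditional expectation of `M` onto `P`, restricted to `N`. -/
noncomputable def condExpOn {P : VonNeumannAlgebra H} (hω : IsStandardForm M ω) (hP : P ≤ M)
    (hN : N ≤ M) : space N →ₗ[ℂ] space P :=
  condExp hω hP ∘ₗ Submodule.inclusion (space_mono hN)

/-- A weakly dense `*`-subalgebra is dense in `2`-norm. -/
theorem apply_mem_closure_of_isWeaklyDenseIn {A : NonUnitalStarSubalgebra ℂ (H →L[ℂ] H)}
    (hA : IsWeaklyDenseIn A N) {x : H →L[ℂ] H} (hx : x ∈ N) (ω : H) :
    x ω ∈ closure {v : H | ∃ a ∈ A, v = a ω} := by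
  let W : Submodule ℂ H := A.toNonUnitalSubalgebra.toSubmodule.map
    (ContinuousLinearMap.apply ℂ H ω).toLinearMap
  have hW : (W : Set H) = {v : H | ∃ a ∈ A, v = a ω} := by
    ext v
    exact ⟨fun ⟨a, ha, h⟩ => ⟨a, ha, h.symm⟩, fun ⟨a, ha, h⟩ => ⟨a, ha, h.symm⟩⟩
  rw [← hW, ← Submodule.topologicalClosure_coe, SetLike.mem_coe,
    ← Submodule.orthogonal_orthogonal_eq_closure, Submodule.mem_orthogonal]
  intro u hu
  -- Orthogonality of `T ω` to a fixed vector is closed in the weak operator topology, so weak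
  -- density already gives norm density of the subspace `Aω`.
  refine closure_minimal (s := (ContinuousLinearMapWOT.ofCLM : (H →L[ℂ] H) → (H →WOT[ℂ] H)) ''
      (A : Set (H →L[ℂ] H))) (t := {T : H →WOT[ℂ] H | inner ℂ u (T ω) = 0}) ?_ ?_ (hA x hx)
  · rintro _ ⟨a, ha, rfl⟩
    exact Submodule.inner_left_of_mem_orthogonal (K := W) ⟨a, ha, rfl⟩ hu
  · exact isClosed_eq (ContinuousLinearMapWOT.continuous_inner_apply continuous_id ω u)
      continuous_const

/-- The standing assumptions: `N` and all `Mk k` are von Neumann subalgebras of `M` and `N` has a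
weakly dense `*`-subalgebra contained in the limes inferior of the `Mk k`. -/
structure IsInLiminf (M N : VonNeumannAlgebra H) (Mk : ℕ → VonNeumannAlgebra H)
    (A : NonUnitalStarSubalgebra ℂ (H →L[ℂ] H)) : Prop where
  le : N ≤ M
  seq_le : ∀ k, Mk k ≤ M
  dense : IsWeaklyDenseIn A N
  subset_liminf : (A : Set (H →L[ℂ] H)) ⊆ liminfVN Mk

variable {Mk : ℕ → VonNeumannAlgebra H} {A : NonUnitalStarSubalgebra ℂ (H →L[ℂ] H)}

theorem IsInLiminf.tendsto_starProjection (h : IsInLiminf M N Mk A) {x : H →L[ℂ] H}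
    (hx : x ∈ N) :
    Tendsto (fun k => (L2 (Mk k) ω).starProjection (x ω)) atTop (𝓝 (x ω)) := by
  refine tendsto_starProjection_of_mem_closure ?_
    (apply_mem_closure_of_isWeaklyDenseIn h.dense hx ω)
  rintro _ ⟨a, ha, rfl⟩
  obtain ⟨y, hy, hya⟩ := h.subset_liminf ha
  exact tendsto_starProjection_of_approx (fun k => mem_L2_of_mem (hy k)) (hya ω).1

theorem IsInLiminf.tendsto_norm_condExp_sub (h : IsInLiminf M N Mk A)
    (hω : IsStandardForm M ω) (x : space N) :
    Tendsto (fun k => ‖(condExpOn hω (h.seq_le k) h.le x : H →L[ℂ] H) ω -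
      (x : H →L[ℂ] H) ω‖) atTop (𝓝 0) := by
  rw [← tendsto_iff_norm_sub_tendsto_zero]
  refine (h.tendsto_starProjection (ω := ω) x.2).congr fun k => ?_
  exact (condExp_apply_trace_vector hω (h.seq_le k)
    (Submodule.inclusion (space_mono h.le) x)).symm

/-- The elements `E_k x - x` are bounded by `2‖x‖` and tend to `0` in `2`-norm, hence σ-weakly in
`M`; normality of `E` transports this to `N`. -/
theorem IsInLiminf.tendsto_condExp (h : IsInLiminf M N Mk A) (hω : IsStandardForm M ω)
    {ξ : space N →ₗ[ℂ] ℂ} (hξ : ξ ∈ predual N) (x : space N) :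
    Tendsto (fun k => ξ (condExpOn hω h.le (h.seq_le k) (condExpOn hω (h.seq_le k) h.le x) - x))
      atTop (𝓝 0) := by
  let i : space N →ₗ[ℂ] space M := Submodule.inclusion (space_mono h.le)
  let T : ℕ → space M := fun k => Submodule.inclusion (space_mono (h.seq_le k))
    (condExpOn hω (h.seq_le k) h.le x) - i x
  have hT : ∀ k, condExp hω h.le (T k) =
      condExpOn hω h.le (h.seq_le k) (condExpOn hω (h.seq_le k) h.le x) - x := fun k => by
    rw [map_sub]
    congr 1
    exact Subtype.ext (condExp_of_mem hω h.le (i x) x.2)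
  have h1 := tendsto_predual_of_dense (T := T) (C := ‖(x : H →L[ℂ] H)‖ + ‖(x : H →L[ℂ] H)‖)
    (fun k => (norm_sub_le _ _).trans
      (add_le_add (norm_condExp_le hω (h.seq_le k) (i x)) le_rfl)) hω.2.1 ?_
    (comp_condExp_mem_predual hω h.le hξ)
  · refine h1.congr fun k => ?_
    rw [LinearMap.comp_apply, hT]
  · rintro _ ⟨m, hm, rfl⟩ _ ⟨n, hn, rfl⟩
    -- Traciality moves `n` off the right vector, so only the `2`-norm of `T k` enters.
    have h2 : ∀ k, inner ℂ (m ω) ((T k : H →L[ℂ] H) (n ω)) =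
        inner ℂ ((m * star n) ω) ((T k : H →L[ℂ] H) ω) := fun k => by
      have h3 := hω.trace_mul_comm (star_mem hm) (mul_mem (T k).2 hn)
      have h4 := hω.trace_mul_comm (mul_mem hn (star_mem hm)) (T k).2
      rw [← star_star (m * star n), inner_star_apply, star_mul, star_star, h4, ← inner_apply_star]
      exact h3
    simp only [h2]
    rw [tendsto_zero_iff_norm_tendsto_zero]
    have h3 := (h.tendsto_norm_condExp_sub hω x).const_mul ‖(m * star n) ω‖
    rw [mul_zero] at h3
    exact squeeze_zero (fun _ => norm_nonneg _) (fun k => norm_inner_le_norm _ _) h3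

/-- Finitely many elements of `N` are approximated by maps that factor through some `Mk k`. -/
theorem IsInLiminf.exists_approx (h : IsInLiminf M N Mk A) (hω : IsStandardForm M ω)
    {ι : Type*} [Finite ι] {ξ : ι → (space N →ₗ[ℂ] ℂ)} (hξ : ∀ i, ξ i ∈ predual N)
    (x : ι → space N) {ε : ℝ} (hε : 0 < ε) {p : ℕ → Prop} (hp : ∃ᶠ k in atTop, p k) :
    ∃ k, p k ∧ ∀ Φ : ℕ → ι → space (Mk k),
      (∀ i, ∀ ξ' ∈ predual (Mk k), Tendsto (fun j => ξ' (Φ j i -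
        condExpOn hω (h.seq_le k) h.le (x i))) atTop (𝓝 0)) →
      ∃ j, ∀ i, ‖ξ i (condExpOn hω h.le (h.seq_le k) (Φ j i) - x i)‖ < ε := by
  have h1 : ∀ᶠ k in atTop, ∀ i, ‖ξ i (condExpOn hω h.le (h.seq_le k)
      (condExpOn hω (h.seq_le k) h.le (x i)) - x i)‖ < ε / 2 := by
    rw [eventually_all]
    intro i
    have := (h.tendsto_condExp hω (hξ i) (x i)).norm
    rw [norm_zero] at this
    exact this.eventually_lt_const (by positivity)
  obtain ⟨k, hk, h2⟩ := (hp.and_eventually h1).exists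
  refine ⟨k, hk, fun Φ hΦ => ?_⟩
  have h3 : ∀ᶠ j in atTop, ∀ i, ‖ξ i (condExpOn hω h.le (h.seq_le k) (Φ j i -
      condExpOn hω (h.seq_le k) h.le (x i)))‖ < ε / 2 := by
    rw [eventually_all]
    intro i
    have := (hΦ i _ (comp_inclusion_mem_predual (space_mono (h.seq_le k))
      (comp_condExp_mem_predual hω h.le (hξ i)))).norm
    rw [norm_zero] at this
    exact this.eventually_lt_const (by positivity)
  obtain ⟨j, hj⟩ := h3.exists
  refine ⟨j, fun i => ?_⟩
  have h4 := hj i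
  have h5 := h2 i
  rw [map_sub] at h4
  have h6 : condExpOn hω h.le (h.seq_le k) (Φ j i) - x i =
      (condExpOn hω h.le (h.seq_le k) (Φ j i) -
        condExpOn hω h.le (h.seq_le k) (condExpOn hω (h.seq_le k) h.le (x i))) +
      (condExpOn hω h.le (h.seq_le k) (condExpOn hω (h.seq_le k) h.le (x i)) - x i) := by abel
  rw [h6, map_add]
  exact (norm_add_le _ _).trans_lt (by linarith)

end Limits

end VNLiminf

namespace VNLiminf

/-! ### The completely bounded norm -/

section CompletelyBounded

variable {H : Type*} [NormedAddCommGroup H] [InnerProductSpace ℂ H]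
  {K : Type*} [NormedAddCommGroup K] [InnerProductSpace ℂ K]

theorem norm_matOp_one (x : H →L[ℂ] H) : ‖matOp fun _ _ : Fin 1 => x‖ = ‖x‖ := by
  have h1 : ∀ v : PiLp 2 (fun _ : Fin 1 => H), ‖v‖ = ‖v 0‖ := fun v => by
    rw [← sq_eq_sq₀ (norm_nonneg _) (norm_nonneg _), PiLp.norm_sq_eq_of_L2]
    simp
  have h0 := norm_nonneg (matOp fun _ _ : Fin 1 => x)
  refine le_antisymm (ContinuousLinearMap.opNorm_le_bound _ (norm_nonneg _) fun v => ?_)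
    (ContinuousLinearMap.opNorm_le_bound x h0 fun v => ?_)
  · rw [h1, h1 v, matOp_apply]
    simpa using x.le_opNorm (v 0)
  · have h2 := (matOp fun _ _ : Fin 1 => x).le_opNorm (embedAt 0 v)
    rw [h1, h1 (embedAt 0 v), matOp_embedAt, embedAt_apply, if_pos rfl] at h2
    exact h2

theorem matOp_smul_add {n : ℕ} (s t : ℂ) (a b : Fin n → Fin n → (H →L[ℂ] H)) :
    matOp (fun i j => s • a i j + t • b i j) = s • matOp a + t • matOp b := by
  ext v i
  simp [matOp_apply, Finset.sum_add_distrib, Finset.smul_sum]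

variable {X : Submodule ℂ (H →L[ℂ] H)} {φ : X →ₗ[ℂ] (K →L[ℂ] K)}

theorem cbNorm_le_iff {c : ℝ≥0} :
    cbNorm φ ≤ c ↔ ∀ (n : ℕ) (a : Fin n → Fin n → X),
      ‖matOp (fun i j => (a i j : H →L[ℂ] H))‖ ≤ 1 → ‖matOp (fun i j => φ (a i j))‖ ≤ c := by
  simp only [cbNorm, iSup_le_iff, enorm_le_coe]
  rfl

theorem norm_apply_le_of_cbNorm_le {c : ℝ≥0} (h : cbNorm φ ≤ c) (x : X) :
    ‖φ x‖ ≤ c * ‖(x : H →L[ℂ] H)‖ := by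
  rcases eq_or_ne x 0 with rfl | hx
  · simp
  have hx0 : 0 < ‖(x : H →L[ℂ] H)‖ := norm_pos_iff.2 fun h => hx (Subtype.ext h)
  have h1 := cbNorm_le_iff.1 h 1 (fun _ _ => ((‖(x : H →L[ℂ] H)‖⁻¹ : ℝ) : ℂ) • x) <| by
    rw [norm_matOp_one, Submodule.coe_smul, norm_smul, Complex.norm_of_nonneg (by positivity),
      inv_mul_cancel₀ hx0.ne']
  rw [norm_matOp_one, map_smul, norm_smul, Complex.norm_of_nonneg (by positivity),
    inv_mul_le_iff₀ hx0] at h1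
  linarith

end CompletelyBounded

/-! ### Linear structure of the predual -/

section Predual

variable {H : Type*} [NormedAddCommGroup H] [InnerProductSpace ℂ H] [CompleteSpace H]
  {N : VonNeumannAlgebra H}

/-- The two sequences of vectors are interleaved along even and odd indices. -/
theorem add_mem_predual {ξ ξ' : space N →ₗ[ℂ] ℂ} (h : ξ ∈ predual N) (h' : ξ' ∈ predual N) :
    ξ + ξ' ∈ predual N := by
  obtain ⟨ζ, η, hζ, hη, hs⟩ := h
  obtain ⟨ζ', η', hζ', hη', hs'⟩ := h'
  have he : ∀ n, (2 * n) % 2 = 0 := fun n => by omega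
  have ho : ∀ n, (2 * n + 1) % 2 ≠ 0 := fun n => by omega
  have hd : ∀ n, (2 * n) / 2 = n := fun n => by omega
  have hd' : ∀ n, (2 * n + 1) / 2 = n := fun n => by omega
  refine ⟨fun n => if n % 2 = 0 then ζ (n / 2) else ζ' (n / 2),
    fun n => if n % 2 = 0 then η (n / 2) else η' (n / 2), ?_, ?_, fun x => ?_⟩
  · refine (HasSum.even_add_odd (m := ∑' n, ‖ζ n‖ ^ 2) (m' := ∑' n, ‖ζ' n‖ ^ 2) ?_ ?_).summable
    · simpa only [he, hd, if_true] using hζ.hasSum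
    · simpa only [ho, hd', if_false] using hζ'.hasSum
  · refine (HasSum.even_add_odd (m := ∑' n, ‖η n‖ ^ 2) (m' := ∑' n, ‖η' n‖ ^ 2) ?_ ?_).summable
    · simpa only [he, hd, if_true] using hη.hasSum
    · simpa only [ho, hd', if_false] using hη'.hasSum
  · refine HasSum.even_add_odd ?_ ?_
    · simpa only [he, hd, if_true] using hs x
    · simpa only [ho, hd', if_false] using hs' x

theorem smul_mem_predual (c : ℂ) {ξ : space N →ₗ[ℂ] ℂ} (h : ξ ∈ predual N) :
    c • ξ ∈ predual N := by
  obtain ⟨ζ, η, hζ, hη, hs⟩ := h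
  refine ⟨ζ, fun n => c • η n, hζ, ?_, fun x => ?_⟩
  · simp only [norm_smul, mul_pow]
    exact hη.mul_left _
  · simp only [map_smul, inner_smul_right]
    exact (hs x).mul_left c

end Predual

/-! ### The Haagerup invariant -/

section CBApprox

variable {H : Type*} [NormedAddCommGroup H] [InnerProductSpace ℂ H] [CompleteSpace H]
  {M N : VonNeumannAlgebra H} {ω : H}

/-- Normal finite rank maps of completely bounded norm at most `c`. -/
structure IsCBFiniteRank {N P : VonNeumannAlgebra H} (c : ℝ≥0)
    (Φ : space N →ₗ[ℂ] space P) : Prop where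
  normal : ∀ ξ ∈ predual P, ξ ∘ₗ Φ ∈ predual N
  finite : FiniteDimensional ℂ (LinearMap.range Φ)
  cb : cbNorm ((space P).subtype ∘ₗ Φ) ≤ c

theorem IsCBFiniteRank.smul_add {c : ℝ≥0} {Φ Ψ : space N →ₗ[ℂ] space N}
    (hΦ : IsCBFiniteRank c Φ) (hΨ : IsCBFiniteRank c Ψ) {s t : ℝ} (hs : 0 ≤ s) (ht : 0 ≤ t)
    (hst : s + t = 1) : IsCBFiniteRank c ((s : ℂ) • Φ + (t : ℂ) • Ψ) where
  normal ξ hξ := by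
    rw [LinearMap.comp_add, LinearMap.comp_smul, LinearMap.comp_smul]
    exact add_mem_predual (smul_mem_predual _ (hΦ.normal ξ hξ))
      (smul_mem_predual _ (hΨ.normal ξ hξ))
  finite := by
    have := hΦ.finite
    have := hΨ.finite
    refine Submodule.finiteDimensional_of_le
      (S₂ := LinearMap.range Φ ⊔ LinearMap.range Ψ) ?_
    rintro _ ⟨x, rfl⟩
    exact Submodule.add_mem_sup (Submodule.smul_mem _ _ ⟨x, rfl⟩)
      (Submodule.smul_mem _ _ ⟨x, rfl⟩)
  cb := cbNorm_le_iff.2 fun n a ha => by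
    have h1 := cbNorm_le_iff.1 hΦ.cb n a ha
    have h2 := cbNorm_le_iff.1 hΨ.cb n a ha
    have h3 := matOp_smul_add s t (fun i j => (Φ (a i j) : H →L[ℂ] H))
      (fun i j => (Ψ (a i j) : H →L[ℂ] H))
    change ‖matOp fun i j => (s : ℂ) • (Φ (a i j) : H →L[ℂ] H) +
      (t : ℂ) • (Ψ (a i j) : H →L[ℂ] H)‖ ≤ c
    rw [h3]
    refine (norm_add_le _ _).trans ?_
    rw [norm_smul, norm_smul, Complex.norm_of_nonneg hs, Complex.norm_of_nonneg ht]
    change ‖matOp fun i j => (Φ (a i j) : H →L[ℂ] H)‖ ≤ c at h1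
    change ‖matOp fun i j => (Ψ (a i j) : H →L[ℂ] H)‖ ≤ c at h2
    calc _ ≤ s * c + t * c := by gcongr
      _ = c := by rw [← add_mul, hst, one_mul]

/-- Compression of finite rank maps by conditional expectations. -/
theorem IsCBFiniteRank.condExp {P : VonNeumannAlgebra H} (hω : IsStandardForm M ω)
    (hP : P ≤ M) (hN : N ≤ M) {c : ℝ≥0} {Φ : space P →ₗ[ℂ] space P}
    (hΦ : IsCBFiniteRank c Φ) :
    IsCBFiniteRank c (condExpOn hω hN hP ∘ₗ Φ ∘ₗ condExpOn hω hP hN) where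
  normal ξ hξ := comp_inclusion_mem_predual (space_mono hN)
    (comp_condExp_mem_predual hω hP (hΦ.normal _
      (comp_inclusion_mem_predual (space_mono hP) (comp_condExp_mem_predual hω hN hξ))))
  finite := by
    have := hΦ.finite
    have h1 : LinearMap.range (condExpOn hω hN hP ∘ₗ Φ ∘ₗ condExpOn hω hP hN) ≤
        (LinearMap.range Φ).map (condExpOn hω hN hP) := by
      rintro _ ⟨x, rfl⟩
      exact ⟨_, ⟨_, rfl⟩, rfl⟩
    exact Submodule.finiteDimensional_of_le h1
  cb := cbNorm_le_iff.2 fun n a ha =>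
    (norm_matOp_condExp_le hω hN _).trans
      (cbNorm_le_iff.1 hΦ.cb n _ ((norm_matOp_condExp_le hω hP _).trans ha))

/-- Pointwise weak approximability of the identity by a convex set of normal maps implies norm
approximability in the predual. -/
theorem exists_uniform_of_pointwise {c : ℝ≥0} {ι : Type*} [Fintype ι]
    {ξ : ι → (space N →ₗ[ℂ] ℂ)} (hξ : ∀ i, ξ i ∈ predual N)
    (h : ∀ x : ι → space N, ∀ ε > 0, ∃ Φ : space N →ₗ[ℂ] space N, IsCBFiniteRank c Φ ∧
      ∀ i, ‖ξ i (Φ (x i) - x i)‖ < ε) {ε : ℝ} (hε : 0 < ε) :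
    ∃ Φ : space N →ₗ[ℂ] space N, IsCBFiniteRank c Φ ∧
      ∀ i, ∀ x : space N, ‖ξ i (Φ x - x)‖ ≤ ε * ‖(x : H →L[ℂ] H)‖ := by
  classical
  let S : Set (ι → BoundedDual N) := {f | ∃ Φ : space N →ₗ[ℂ] space N, IsCBFiniteRank c Φ ∧
    ∀ i x, (f i).toLin x = ξ i (Φ x - x)}
  have hmem : ∀ Φ : space N →ₗ[ℂ] space N, IsCBFiniteRank c Φ → ∀ i,
      ξ i ∘ₗ Φ + (-1 : ℂ) • ξ i ∈ predual N := fun Φ hΦ i =>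
    add_mem_predual (hΦ.normal _ (hξ i)) (smul_mem_predual _ (hξ i))
  have hconv : Convex ℝ S := by
    rintro f ⟨Φ, hΦ, hf⟩ g ⟨Ψ, hΨ, hg⟩ s t hs ht hst
    refine ⟨(s : ℂ) • Φ + (t : ℂ) • Ψ, hΦ.smul_add hΨ hs ht hst, fun i x => ?_⟩
    have h1 : (s • f + t • g) i = (s : ℂ) • f i + (t : ℂ) • g i := rfl
    have h2 : x = (s : ℂ) • x + (t : ℂ) • x := by
      rw [← add_smul, ← Complex.ofReal_add, hst, Complex.ofReal_one, one_smul]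
    have h3 : ((s : ℂ) • Φ + (t : ℂ) • Ψ) x - x = (s : ℂ) • (Φ x - x) + (t : ℂ) • (Ψ x - x) := by
      conv_lhs => rw [LinearMap.add_apply, LinearMap.smul_apply, LinearMap.smul_apply]
      nth_rw 3 [h2]
      module
    rw [h1, h3, map_add, map_add, map_smul, map_smul, map_smul, map_smul, LinearMap.add_apply,
      LinearMap.smul_apply, LinearMap.smul_apply, hf, hg]
  have h0 : (0 : ι → BoundedDual N) ∈ closure S := by
    -- A separating functional has real part above some `u > 0` on `S`. As `S` consists of tuples of
    -- normal functionals, it acts there by evaluation at points `z i ∈ N`, which contradicts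
    -- pointwise approximability at these points.
    by_contra h0
    obtain ⟨F, u, hu, hF⟩ := RCLike.geometric_hahn_banach_point_closed (𝕜 := ℂ) hconv.closure
      isClosed_closure h0
    rw [map_zero, map_zero] at hu
    choose z _ hz using fun i => exists_eval_of_dual N
      (F ∘L ContinuousLinearMap.single ℂ (fun _ : ι => BoundedDual N) i)
    -- With this tolerance the sum over `ι` stays below `u`.
    obtain ⟨Φ, hΦ, hΦz⟩ := h z (u / (Fintype.card ι + 1)) (by positivity)
    choose b hb _ using fun i => exists_hasSum_vecFunctional (hmem Φ hΦ i)
    have hbx : ∀ i x, (b i).toLin x = ξ i (Φ x - x) := fun i x => by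
      rw [hb i, map_sub]
      simp [sub_eq_add_neg]
    have h1 := hF b (subset_closure ⟨Φ, hΦ, hbx⟩)
    have h2 : F b = ∑ i, ξ i (Φ (z i) - z i) := by
      rw [← Finset.univ_sum_single b, map_sum]
      refine Finset.sum_congr rfl fun i _ => ?_
      rw [← hbx, ← hz i (b i) (by rw [hb i]; exact hmem Φ hΦ i)]
      rfl
    rw [h2] at h1
    have h3 : ‖∑ i, ξ i (Φ (z i) - z i)‖ ≤ ∑ _i : ι, u / (Fintype.card ι + 1) :=
      norm_sum_le_of_le _ fun i _ => (hΦz i).le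
    rw [Finset.sum_const, Finset.card_univ, nsmul_eq_mul, mul_div_assoc',
      le_div_iff₀ (by positivity)] at h3
    have h4 := (RCLike.re_le_norm (∑ i, ξ i (Φ (z i) - z i))).trans' h1.le
    have : (0 : ℝ) ≤ Fintype.card ι := by positivity
    nlinarith
  obtain ⟨f, ⟨Φ, hΦ, hf⟩, hfε⟩ := Metric.mem_closure_iff.1 h0 ε hε
  refine ⟨Φ, hΦ, fun i x => ?_⟩
  rw [dist_zero_left] at hfε
  rw [← hf]
  refine ((f i).norm_toLin_apply_le x).trans ?_
  gcongr
  exact (norm_le_pi_norm f i).trans hfε.le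

variable [TopologicalSpace.SeparableSpace H]

/-- A diagonal sequence: the `n`-th map handles the first `n` vectors of a dense sequence, uniformly
on the unit ball of `N`. The uniform bound from the completely bounded norm extends convergence to
the whole predual. -/
theorem hasCBApprox_of_pointwise {c : ℝ≥0}
    (h : ∀ {ι : Type} [Fintype ι] {ξ : ι → (space N →ₗ[ℂ] ℂ)}, (∀ i, ξ i ∈ predual N) →
      ∀ x : ι → space N, ∀ ε > 0, ∃ Φ : space N →ₗ[ℂ] space N, IsCBFiniteRank c Φ ∧
        ∀ i, ‖ξ i (Φ (x i) - x i)‖ < ε) : HasCBApprox N c := by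
  let d := TopologicalSpace.denseSeq H
  have hd : Dense (Set.range d) := TopologicalSpace.denseRange_denseSeq H
  have key : ∀ n : ℕ, ∃ Φ : space N →ₗ[ℂ] space N, IsCBFiniteRank c Φ ∧
      ∀ i < n, ∀ l < n, ∀ x : space N, ‖(vecFunctional N (d i) (d l)).toLin (Φ x - x)‖ ≤
        1 / ((n : ℝ) + 1) * ‖(x : H →L[ℂ] H)‖ := fun n => by
    have hmem : ∀ i : Fin n × Fin n, (vecFunctional N (d i.1) (d i.2)).toLin ∈ predual N :=
      fun i => vecFunctional_mem_predual N _ _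
    obtain ⟨Φ, hΦ, hΦd⟩ := exists_uniform_of_pointwise hmem (h hmem)
      (ε := 1 / ((n : ℝ) + 1)) (by positivity)
    exact ⟨Φ, hΦ, fun i hi l hl => hΦd (⟨i, hi⟩, ⟨l, hl⟩)⟩
  choose Φ hΦ hΦd using key
  refine ⟨Φ, fun n => (hΦ n).normal, fun n => (hΦ n).finite, fun n => (hΦ n).cb,
    fun x ξ hξ => ?_⟩
  have hbd : ∀ n, ‖((Φ n x - x : space N) : H →L[ℂ] H)‖ ≤
      c * ‖(x : H →L[ℂ] H)‖ + ‖(x : H →L[ℂ] H)‖ := fun n => by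
    have h1 := norm_apply_le_of_cbNorm_le (hΦ n).cb x
    rw [LinearMap.comp_apply, Submodule.subtype_apply] at h1
    rw [Submodule.coe_sub]
    exact (norm_sub_le _ _).trans (add_le_add_left h1 _)
  refine tendsto_predual_of_dense hbd hd ?_ hξ
  rintro _ ⟨i, rfl⟩ _ ⟨l, rfl⟩
  rw [tendsto_zero_iff_norm_tendsto_zero]
  have h1 := (tendsto_one_div_add_atTop_nhds_zero_nat (𝕜 := ℝ)).mul_const ‖(x : H →L[ℂ] H)‖
  rw [zero_mul] at h1
  have h2 : ∀ᶠ n in atTop, ‖inner ℂ (d i) (((Φ n x - x : space N) : H →L[ℂ] H) (d l))‖ ≤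
      1 / ((n : ℝ) + 1) * ‖(x : H →L[ℂ] H)‖ := by
    filter_upwards [eventually_gt_atTop (max i l)] with n hn
    exact hΦd n i ((le_max_left i l).trans_lt hn) l ((le_max_right i l).trans_lt hn) x
  exact squeeze_zero' (Eventually.of_forall fun _ => norm_nonneg _) h2 h1

variable {Mk : ℕ → VonNeumannAlgebra H} {A : NonUnitalStarSubalgebra ℂ (H →L[ℂ] H)}

theorem IsInLiminf.hasCBApprox (h : IsInLiminf M N Mk A) (hω : IsStandardForm M ω) {c : ℝ≥0}
    (hc : ∃ᶠ k in atTop, HasCBApprox (Mk k) c) : HasCBApprox N c := by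
  refine hasCBApprox_of_pointwise fun {ι} _ {ξ} hξ x ε hε => ?_
  obtain ⟨k, ⟨Φ, h1, h2, h3, h4⟩, hk⟩ := h.exists_approx hω hξ x hε hc
  obtain ⟨j, hj⟩ := hk (fun j i => Φ j (condExpOn hω (h.seq_le k) h.le (x i)))
    fun i ξ' hξ' => h4 _ ξ' hξ'
  exact ⟨_, IsCBFiniteRank.condExp hω (h.seq_le k) h.le ⟨h1 j, h2 j, h3 j⟩, hj⟩

theorem IsInLiminf.haagerupInvariant_le (h : IsInLiminf M N Mk A) (hω : IsStandardForm M ω) :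
    haagerupInvariant N ≤ liminf (fun k => haagerupInvariant (Mk k)) atTop := by
  by_contra! hlt
  obtain ⟨r, hr1, hr2⟩ := ENNReal.lt_iff_exists_nnreal_btwn.1 hlt
  -- For `r` strictly between the two sides, infinitely many `M_k` satisfy the bound `r`, which
  -- suffices because the approximation argument needs only frequently many good indices.
  have h1 := frequently_lt_of_liminf_lt (by isBoundedDefault) hr1
  refine hr2.not_ge (iInf₂_le r (h.hasCBApprox hω (h1.mono fun k hk => ?_)))
  obtain ⟨c, hk⟩ := iInf_lt_iff.1 hk
  obtain ⟨⟨Φ, h1, h2, h3, h4⟩, hk⟩ := iInf_lt_iff.1 hk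
  exact ⟨Φ, h1, h2, fun j => (h3 j).trans hk.le, h4⟩

end CBApprox

end VNLiminf

namespace VNLiminf

/-! ### Weak exactness -/

section WeakExactness

variable {H : Type*} [NormedAddCommGroup H] [InnerProductSpace ℂ H] [CompleteSpace H]
  {M N : VonNeumannAlgebra H} {ω : H} {Mk : ℕ → VonNeumannAlgebra H}
  {A : NonUnitalStarSubalgebra ℂ (H →L[ℂ] H)}

theorem isUCP_condExpOn {P : VonNeumannAlgebra H} (hω : IsStandardForm M ω) (hP : P ≤ M)
    (hN : N ≤ M) : IsUCP ((space P).subtype ∘ₗ condExpOn hω hP hN) :=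
  (isUCP_condExp hω hP).comp_inclusion (space_mono hN)

theorem IsInLiminf.exists_factorization (h : IsInLiminf M N Mk A) (hω : IsStandardForm M ω)
    (hex : ∀ k, IsWeaklyExact (Mk k)) {X : Submodule ℂ (H →L[ℂ] H)} [FiniteDimensional ℂ X]
    (h1 : 1 ∈ X) (hstar : ∀ x ∈ X, star x ∈ X) (hX : X ≤ space N) {ι : Type*} [Finite ι]
    {ξ : ι → (space N →ₗ[ℂ] ℂ)} (hξ : ∀ i, ξ i ∈ predual N) (x : ι → X) {ε : ℝ} (hε : 0 < ε) :
    ∃ (m : ℕ) (φ : X →ₗ[ℂ] (EuclideanSpace ℂ (Fin m) →L[ℂ] EuclideanSpace ℂ (Fin m)))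
      (ψ : LinearMap.range φ →ₗ[ℂ] space N), IsUCP φ ∧ IsUCP ((space N).subtype ∘ₗ ψ) ∧
      ∀ i, ‖ξ i (ψ (φ.rangeRestrict (x i)) - Submodule.inclusion hX (x i))‖ < ε := by
  obtain ⟨k, -, hk⟩ := h.exists_approx hω hξ (fun i => Submodule.inclusion hX (x i)) hε
    (p := fun _ => True) (Frequently.of_forall fun _ => trivial)
  let e : X →ₗ[ℂ] (H →L[ℂ] H) :=
    (space (Mk k)).subtype ∘ₗ condExpOn hω (h.seq_le k) h.le ∘ₗ Submodule.inclusion hX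
  have heU : IsUCP e := (isUCP_condExpOn hω (h.seq_le k) h.le).comp_inclusion hX
  have he : LinearMap.range e ≤ space (Mk k) := by
    rintro _ ⟨y, rfl⟩
    exact Subtype.prop _
  -- The image `E_k(X)` is an operator system in `M_k`, since the expectation is unital and commutes
  -- with `star`.
  obtain ⟨n, φ, ψ, hφ, hψ, hlim⟩ := hex k (LinearMap.range e) inferInstance
    ⟨⟨1, h1⟩, heU.2 _ rfl⟩ (by
      rintro _ ⟨y, rfl⟩
      refine ⟨⟨star (y : H →L[ℂ] H), hstar _ y.2⟩, ?_⟩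
      exact condExp_star hω (h.seq_le k) _ _ rfl) he
  obtain ⟨j, hj⟩ := hk (fun j i => ψ j ((φ j).rangeRestrict (e.rangeRestrict (x i))))
    fun i ξ' hξ' => hlim (e.rangeRestrict (x i)) ξ' hξ'
  have hle : LinearMap.range (φ j ∘ₗ e.rangeRestrict) ≤ LinearMap.range (φ j) :=
    LinearMap.range_comp_le_range _ _
  refine ⟨n j, φ j ∘ₗ e.rangeRestrict,
    condExpOn hω h.le (h.seq_le k) ∘ₗ ψ j ∘ₗ Submodule.inclusion hle, ?_, ?_, hj⟩
  · exact (hφ j).comp (φ := e.rangeRestrict) heU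
  · exact (isUCP_condExpOn hω h.le (h.seq_le k)).comp (φ := ψ j ∘ₗ Submodule.inclusion hle)
      ((hψ j).comp_inclusion hle)

/-- As `X` is finite dimensional, control on a basis and on a dense sequence of vectors is enough;
the maps `ψ ∘ φ` are contractive on `X`, which yields σ-weak convergence. -/
theorem IsInLiminf.isWeaklyExact [TopologicalSpace.SeparableSpace H]
    (h : IsInLiminf M N Mk A) (hω : IsStandardForm M ω)
    (hex : ∀ k, IsWeaklyExact (Mk k)) : IsWeaklyExact N := by
  intro X _ h1 hstar hX
  let d := TopologicalSpace.denseSeq H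
  have hd : Dense (Set.range d) := TopologicalSpace.denseRange_denseSeq H
  let b := Module.finBasis ℂ X
  have key : ∀ n : ℕ, ∃ (m : ℕ)
      (φ : X →ₗ[ℂ] (EuclideanSpace ℂ (Fin m) →L[ℂ] EuclideanSpace ℂ (Fin m)))
      (ψ : LinearMap.range φ →ₗ[ℂ] space N), IsUCP φ ∧ IsUCP ((space N).subtype ∘ₗ ψ) ∧
      ∀ i < n, ∀ l < n, ∀ s, ‖(vecFunctional N (d i) (d l)).toLin
        (ψ (φ.rangeRestrict (b s)) - Submodule.inclusion hX (b s))‖ < 1 / ((n : ℝ) + 1) := by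
    intro n
    have hmem : ∀ i : Fin n × Fin n × Fin (Module.finrank ℂ X),
        (vecFunctional N (d i.1) (d i.2.1)).toLin ∈ predual N :=
      fun i => vecFunctional_mem_predual N _ _
    obtain ⟨m, φ, ψ, hφ, hψ, hb⟩ := h.exists_factorization hω hex h1 hstar hX hmem
      (fun i => b i.2.2) (ε := 1 / ((n : ℝ) + 1)) (by positivity)
    exact ⟨m, φ, ψ, hφ, hψ, fun i hi l hl s => hb (⟨i, hi⟩, ⟨l, hl⟩, s)⟩
  choose m φ ψ hφ hψ hb using key
  refine ⟨m, φ, ψ, hφ, hψ, fun x ξ hξ => ?_⟩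
  have hbd : ∀ n, ‖((ψ n ((φ n).rangeRestrict x) - Submodule.inclusion hX x : space N) :
      H →L[ℂ] H)‖ ≤ ‖(x : H →L[ℂ] H)‖ + ‖(x : H →L[ℂ] H)‖ := fun n => by
    have h2 := ((hψ n).comp (φ := (φ n).rangeRestrict) (hφ n)).norm_apply_le h1 (hstar x x.2)
    rw [Submodule.coe_sub]
    exact (norm_sub_le _ _).trans (add_le_add_left h2 _)
  refine tendsto_predual_of_dense hbd hd ?_ hξ
  rintro _ ⟨i, rfl⟩ _ ⟨l, rfl⟩
  let g : ℕ → X →ₗ[ℂ] ℂ := fun n => (vecFunctional N (d i) (d l)).toLin ∘ₗ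
    (ψ n ∘ₗ (φ n).rangeRestrict - Submodule.inclusion hX)
  have hgb : ∀ s, Tendsto (fun n => g n (b s)) atTop (𝓝 0) := fun s => by
    rw [tendsto_zero_iff_norm_tendsto_zero]
    have h2 : ∀ᶠ n : ℕ in atTop, ‖g n (b s)‖ ≤ 1 / ((n : ℝ) + 1) := by
      filter_upwards [eventually_gt_atTop (max i l)] with n hn
      exact (hb n i ((le_max_left i l).trans_lt hn) l ((le_max_right i l).trans_lt hn) s).le
    exact squeeze_zero' (Eventually.of_forall fun _ => norm_nonneg _) h2
      tendsto_one_div_add_atTop_nhds_zero_nat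
  have hgx : Tendsto (fun n => g n x) atTop (𝓝 0) := by
    have h2 : ∀ n, g n x = ∑ s, b.repr x s * g n (b s) := fun n => by
      conv_lhs => rw [← b.sum_repr x]
      simp only [map_sum, map_smul, smul_eq_mul]
    simp only [h2]
    rw [← Finset.sum_const_zero (ι := Fin (Module.finrank ℂ X)) (s := Finset.univ)]
    refine tendsto_finsetSum _ fun s _ => ?_
    simpa using (hgb s).const_mul (b.repr x s)
  exact hgx

end WeakExactness

/-! ### The Haagerup approximation property -/

section HaagerupProperty

variable {H : Type*} [NormedAddCommGroup H] [InnerProductSpace ℂ H] [CompleteSpace H]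
  {M N : VonNeumannAlgebra H} {ω : H} {Mk : ℕ → VonNeumannAlgebra H}
  {A : NonUnitalStarSubalgebra ℂ (H →L[ℂ] H)}

/-- The maps that occur in the Haagerup approximation property. -/
structure IsHaagerupMap (N : VonNeumannAlgebra H) (ω : H) (φ : space N →ₗ[ℂ] space N) :
    Prop where
  ucp : IsUCP ((space N).subtype ∘ₗ φ)
  trace : ∀ x : space N,
    inner ℂ ω ((φ x : H →L[ℂ] H) ω) = inner ℂ ω ((x : H →L[ℂ] H) ω)
  compact : ∃ T : L2 N ω →L[ℂ] L2 N ω, IsCompactOperator T ∧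
    ∀ x : space N, T ⟨(x : H →L[ℂ] H) ω, apply_mem_L2 N ω x⟩ =
      ⟨(φ x : H →L[ℂ] H) ω, apply_mem_L2 N ω (φ x)⟩

/-- Kadison-Schwarz in the trace vector, followed by trace preservation applied to `x* x`. -/
theorem IsHaagerupMap.norm_apply_le {φ : space N →ₗ[ℂ] space N} (hφ : IsHaagerupMap N ω φ)
    (x : space N) : ‖(φ x : H →L[ℂ] H) ω‖ ≤ ‖(x : H →L[ℂ] H) ω‖ := by
  have hxN : (x : H →L[ℂ] H) ∈ N := x.2
  let z : space N := ⟨star (x : H →L[ℂ] H) * x,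
    show star (x : H →L[ℂ] H) * x ∈ N from mul_mem (star_mem hxN) hxN⟩
  have hz : ∀ v, (inner ℂ v ((z : H →L[ℂ] H) v)).re = ‖(x : H →L[ℂ] H) v‖ ^ 2 := fun v => by
    change (inner ℂ v (star (x : H →L[ℂ] H) ((x : H →L[ℂ] H) v))).re = _
    rw [inner_apply_star]
    exact inner_self_eq_norm_sq (𝕜 := ℂ) _
  have h1 := hφ.ucp.kadison_schwarz (one_mem N) (x := x)
    (y := ⟨star (x : H →L[ℂ] H), show star (x : H →L[ℂ] H) ∈ N from star_mem hxN⟩) (z := z) rfl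
    (IsSelfAdjoint.star_mul_self _) (fun v => (hz v).ge) ω
  have h2 : (inner ℂ ω ((φ z : H →L[ℂ] H) ω)).re = ‖(x : H →L[ℂ] H) ω‖ ^ 2 := by
    rw [hφ.trace, hz]
  exact (sq_le_sq₀ (norm_nonneg _) (norm_nonneg _)).1 (h1.trans_eq h2)

theorem trace_condExpOn {P : VonNeumannAlgebra H} (hω : IsStandardForm M ω) (hP : P ≤ M)
    (hN : N ≤ M) (x : space N) :
    inner ℂ ω ((condExpOn hω hP hN x : H →L[ℂ] H) ω) = inner ℂ ω ((x : H →L[ℂ] H) ω) :=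
  trace_condExp_mul hω hP (Submodule.inclusion (space_mono hN) x) (one_mem P)

theorem condExpOn_apply_trace_vector {P : VonNeumannAlgebra H} (hω : IsStandardForm M ω)
    (hP : P ≤ M) (hN : N ≤ M) (x : space N) :
    (condExpOn hω hP hN x : H →L[ℂ] H) ω = (L2 P ω).starProjection ((x : H →L[ℂ] H) ω) :=
  condExp_apply_trace_vector hω hP (Submodule.inclusion (space_mono hN) x)

theorem IsHaagerupMap.condExp {P : VonNeumannAlgebra H} (hω : IsStandardForm M ω)
    (hP : P ≤ M) (hN : N ≤ M) {φ : space P →ₗ[ℂ] space P} (hφ : IsHaagerupMap P ω φ) :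
    IsHaagerupMap N ω (condExpOn hω hN hP ∘ₗ φ ∘ₗ condExpOn hω hP hN) where
  ucp := (isUCP_condExpOn hω hN hP).comp (φ := φ ∘ₗ condExpOn hω hP hN)
    (hφ.ucp.comp (isUCP_condExpOn hω hP hN))
  trace x := by
    rw [LinearMap.comp_apply, LinearMap.comp_apply, trace_condExpOn, hφ.trace, trace_condExpOn]
  compact := by
    obtain ⟨T, hT, hTφ⟩ := hφ.compact
    let S : L2 P ω →L[ℂ] L2 N ω := (L2 N ω).orthogonalProjectionOnto ∘L (L2 P ω).subtypeL
    let R : L2 N ω →L[ℂ] L2 P ω := (L2 P ω).orthogonalProjectionOnto ∘L (L2 N ω).subtypeL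
    -- The expectations induce the projections `R` and `S` on the `L²` spaces, and composing with
    -- bounded operators preserves compactness.
    refine ⟨S ∘L T ∘L R, (hT.comp_clm R).clm_comp S, fun x => Subtype.ext ?_⟩
    have h1 : (L2 P ω).orthogonalProjectionOnto ((x : H →L[ℂ] H) ω) =
        ⟨(condExpOn hω hP hN x : H →L[ℂ] H) ω, apply_mem_L2 P ω _⟩ :=
      Subtype.ext (condExpOn_apply_trace_vector hω hP hN x).symm
    change ((L2 N ω).orthogonalProjectionOnto (T ((L2 P ω).orthogonalProjectionOnto
      ((x : H →L[ℂ] H) ω)) : H) : H) = _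
    rw [h1, hTφ]
    exact (condExpOn_apply_trace_vector hω hN hP _).symm

theorem IsInLiminf.exists_isHaagerupMap (h : IsInLiminf M N Mk A) (hω : IsStandardForm M ω)
    (hap : ∀ k, HasHaagerupAP (Mk k) ω) {ι : Type*} [Finite ι] (x : ι → space N) {ε : ℝ}
    (hε : 0 < ε) :
    ∃ Ψ : space N →ₗ[ℂ] space N, IsHaagerupMap N ω Ψ ∧
      ∀ i, ‖(Ψ (x i) : H →L[ℂ] H) ω - (x i : H →L[ℂ] H) ω‖ < ε := by
  have h1 : ∀ᶠ k in atTop, ∀ i, ‖(condExpOn hω (h.seq_le k) h.le (x i) : H →L[ℂ] H) ω -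
      (x i : H →L[ℂ] H) ω‖ < ε / 2 := by
    rw [eventually_all]
    exact fun i => (h.tendsto_norm_condExp_sub hω (x i)).eventually_lt_const (by positivity)
  obtain ⟨k, hk⟩ := h1.exists
  obtain ⟨φ, hφ1, hφ2, hφ3, hφ4⟩ := hap k
  have h2 : ∀ᶠ j in atTop, ∀ i, ‖((φ j (condExpOn hω (h.seq_le k) h.le (x i)) -
      condExpOn hω (h.seq_le k) h.le (x i) : space (Mk k)) : H →L[ℂ] H) ω‖ < ε / 2 := by
    rw [eventually_all]
    exact fun i => (hφ3 _).eventually_lt_const (by positivity)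
  obtain ⟨j, hj⟩ := h2.exists
  refine ⟨_, IsHaagerupMap.condExp hω (h.seq_le k) h.le ⟨hφ1 j, hφ2 j, hφ4 j⟩, fun i => ?_⟩
  have h3 := hj i
  rw [Submodule.coe_sub, sub_apply] at h3
  -- Both vectors are projections onto `L2 N ω`, so their distance is at most that of `φ j (E_k x)
  -- ω` from `x ω`.
  have h4 : (x i : H →L[ℂ] H) ω = (L2 N ω).starProjection ((x i : H →L[ℂ] H) ω) :=
    (Submodule.starProjection_eq_self_iff.2 (apply_mem_L2 N ω (x i))).symm
  rw [LinearMap.comp_apply, LinearMap.comp_apply, condExpOn_apply_trace_vector]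
  rw [h4, ← map_sub]
  refine (Submodule.norm_starProjection_apply_le _ _).trans_lt ?_
  have h5 := norm_sub_le_norm_sub_add_norm_sub
    ((φ j (condExpOn hω (h.seq_le k) h.le (x i)) : H →L[ℂ] H) ω)
    ((condExpOn hω (h.seq_le k) h.le (x i) : H →L[ℂ] H) ω) ((x i : H →L[ℂ] H) ω)
  exact h5.trans_lt (by linarith [hk i])

theorem exists_seq_dense_trace_vectors [TopologicalSpace.SeparableSpace H]
    (N : VonNeumannAlgebra H) (ω : H) :
    ∃ x : ℕ → space N, ∀ (y : space N) (ε : ℝ), 0 < ε →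
      ∃ i, ‖(y : H →L[ℂ] H) ω - (x i : H →L[ℂ] H) ω‖ < ε := by
  let f : space N → H := fun x => (x : H →L[ℂ] H) ω
  obtain ⟨t, ht, htc, htd⟩ :=
    (TopologicalSpace.IsSeparable.of_separableSpace (Set.range f)).exists_countable_dense_subset
  have hne : t.Nonempty := closure_nonempty_iff.1 ⟨_, htd ⟨0, rfl⟩⟩
  obtain ⟨g, rfl⟩ := htc.exists_eq_range hne
  choose x hx using fun i => ht ⟨i, rfl⟩
  refine ⟨x, fun y ε hε => ?_⟩
  obtain ⟨_, ⟨i, rfl⟩, hi⟩ := Metric.mem_closure_iff.1 (htd ⟨y, rfl⟩) ε hε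
  rw [← hx, dist_eq_norm] at hi
  exact ⟨i, hi⟩

theorem IsInLiminf.hasHaagerupAP [TopologicalSpace.SeparableSpace H]
    (h : IsInLiminf M N Mk A) (hω : IsStandardForm M ω)
    (hap : ∀ k, HasHaagerupAP (Mk k) ω) : HasHaagerupAP N ω := by
  obtain ⟨x, hx⟩ := exists_seq_dense_trace_vectors N ω
  have key : ∀ n : ℕ, ∃ Ψ : space N →ₗ[ℂ] space N, IsHaagerupMap N ω Ψ ∧
      ∀ i < n, ‖(Ψ (x i) : H →L[ℂ] H) ω - (x i : H →L[ℂ] H) ω‖ < 1 / ((n : ℝ) + 1) := by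
    intro n
    obtain ⟨Ψ, hΨ, hi⟩ := h.exists_isHaagerupMap hω hap (fun i : Fin n => x i)
      (ε := 1 / ((n : ℝ) + 1)) (by positivity)
    exact ⟨Ψ, hΨ, fun i hin => hi ⟨i, hin⟩⟩
  choose Ψ hΨ hΨx using key
  refine ⟨Ψ, fun n => (hΨ n).ucp, fun n => (hΨ n).trace, fun y => ?_, fun n => (hΨ n).compact⟩
  rw [Metric.tendsto_atTop]
  intro ε hε
  obtain ⟨i, hi⟩ := hx y (ε / 3) (by positivity)
  obtain ⟨n₀, hn₀⟩ := exists_nat_one_div_lt (show 0 < ε / 3 by positivity)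
  -- The `n`-th map controls only `x i` with `i < n`; contractivity in `2`-norm passes the estimate
  -- from `x i` to `y`.
  refine ⟨max n₀ (i + 1), fun n hn => ?_⟩
  have h1 := hΨx n i (Nat.lt_of_succ_le ((le_max_right _ _).trans hn))
  have h2 : 1 / ((n : ℝ) + 1) ≤ 1 / ((n₀ : ℝ) + 1) := by
    gcongr
    exact (le_max_left _ _).trans hn
  have h3 := (hΨ n).norm_apply_le (y - x i)
  rw [map_sub, Submodule.coe_sub, Submodule.coe_sub, sub_apply, sub_apply] at h3
  rw [dist_zero_right, norm_norm, Submodule.coe_sub, sub_apply]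
  have h4 : (Ψ n y : H →L[ℂ] H) ω - (y : H →L[ℂ] H) ω =
      ((Ψ n y : H →L[ℂ] H) ω - (Ψ n (x i) : H →L[ℂ] H) ω) +
      (((Ψ n (x i) : H →L[ℂ] H) ω - (x i : H →L[ℂ] H) ω) -
        ((y : H →L[ℂ] H) ω - (x i : H →L[ℂ] H) ω)) := by abel
  rw [h4]
  refine (norm_add_le _ _).trans_lt ?_
  have h5 := norm_sub_le ((Ψ n (x i) : H →L[ℂ] H) ω - (x i : H →L[ℂ] H) ω)
    ((y : H →L[ℂ] H) ω - (x i : H →L[ℂ] H) ω)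
  linarith

end HaagerupProperty

end VNLiminf

theorem corollary3p5 {H : Type*} [NormedAddCommGroup H] [InnerProductSpace ℂ H]
    [CompleteSpace H] [TopologicalSpace.SeparableSpace H]
    (M : VonNeumannAlgebra H) (hM : VNLiminf.IsIIOneFactor M)
    (ω : H) (hω : VNLiminf.IsStandardForm M ω)
    (N : VonNeumannAlgebra H) (hN : N ≤ M)
    (Mk : ℕ → VonNeumannAlgebra H) (hMk : ∀ k, Mk k ≤ M)
    (A : NonUnitalStarSubalgebra ℂ (H →L[ℂ] H))
    (hAN : (A : Set (H →L[ℂ] H)) ⊆ (N : Set (H →L[ℂ] H)))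
    (hAdense : VNLiminf.IsWeaklyDenseIn A N)
    (hAlim : (A : Set (H →L[ℂ] H)) ⊆ VNLiminf.liminfVN Mk) :
    VNLiminf.haagerupInvariant N ≤
        Filter.liminf (fun k => VNLiminf.haagerupInvariant (Mk k)) Filter.atTop ∧
      ((∀ k, VNLiminf.IsWeaklyExact (Mk k)) → VNLiminf.IsWeaklyExact N) ∧
      ((∀ k, VNLiminf.HasHaagerupAP (Mk k) ω) → VNLiminf.HasHaagerupAP N ω) := by
  have h : VNLiminf.IsInLiminf M N Mk A := ⟨hN, hMk, hAdense, hAlim⟩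
  exact ⟨h.haagerupInvariant_le hω, h.isWeaklyExact hω, h.hasHaagerupAP hω⟩
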